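/- Write $e(x)=e^{2\pi i x}$, $\mathbb T=\mathbb R/\mathbb Z$, let $\{x\}\in[0,1)$ be the fractional part and $\|x\|_{\mathbb T}$ the distance from $x$ to the nearest integer. Let $P(m)=b_dm^d+\dots+b_1m+b_0$ with $b_j\in\mathbb Z$ and $b_d>0$. For a function $g$ on $\mathbb Z$ and an integer $t\ge1$ let $$K_t*g(x)=\frac1t\sum_{m=1}^{t} g(x+P(m)),$$ and for $n\ge 0$ let $$\mathcal V^2_n(K_t*g)(x)=\sup_{2^n\le t_0<t_1<\dots<t_k\le 2^{n+1}}\Big(\sum_{j<k}|K_{t_j}*g(x)-K_{t_{j+1}}*g(x)|^2\Big)^{1/2}$$ be the short $2$-variation over the $n$-th dyadic block ($t_j$ and $k\ge 0$ integers). For an integer $s\ge0$ let $\mathcal R_s$ be the set of reduced fractions $a/q\in[0,1)$ with $2^s\le q<2^{s+1}$ (so $\mathcal R_0=\{0/1\}$). For $\delta>0$ define the $n$-major arcs $$\mathfrak M_n=\bigcup_{0\le s\le n\delta}\ \bigcup_{a/q\in\mathcal R_s}\mathfrak M_n(a/q),\qquad \mathfrak M_n(a/q)=\{\alpha\in\mathbb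 T: |\{b_d\alpha\}-a/q|<2^{-n(d-\delta)}\},$$ where for $a/q=0/1$ the quantity $|\{b_d\alpha\}-a/q|$ is replaced by $\|b_d\alpha\|_{\mathbb T}$. For $f\in\ell^2(\mathbb Z)$ let $\hat f(\alpha)=\sum_m f(m)e(-m\alpha)\in L^2(\mathbb T)$ and let $f_{\mathfrak M_n}(m)=\int_{\mathfrak M_n}\hat f(\alpha)e(m\alpha)\,d\alpha$ be the frequency projection of $f$ onto $\mathfrak M_n$. Then there is an absolute constant $\delta_0>0$ such that for every such polynomial $P$ and every $0<\delta<\delta_0$ there is a finite constant $C$, depending only on $P$ and $\delta$, with $$\sum_{n\ge0}\big\|\mathcal V^2_n(K_t*f_{\mathfrak M_n})\big\|_{\ell^2(\mathbb Z)}^2\le C\,\|f\|_{\ell^2(\mathbb Z)}^2\qquad\text{for all } f\in\ell^2(\mathbb Z).$$ -/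

import Mathlib

open scoped ENNReal NNReal Polynomial

namespace PolyVariation

/-- The space `ℓ²(ℤ)` of square-summable complex-valued functions on the integers. -/
abbrev EllTwo : Type := lp (fun _ : ℤ => ℂ) 2

/-- The space `L²(𝕋)`, where `𝕋 = ℝ/ℤ` carries its Lebesgue (Haar) probability measure. -/
abbrev CircleLTwo : Type :=
  MeasureTheory.Lp ℂ 2 (AddCircle.haarAddCircle : MeasureTheory.Measure UnitAddCircle)

/-- The Fourier transform `f̂(α) = ∑ₘ f(m) e(-mα)` of `f ∈ ℓ²(ℤ)`; the series converges
unconditionally in `L²(𝕋)`, see `hasSum_latticeFourier`. -/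
noncomputable def latticeFourier (f : EllTwo) : CircleLTwo :=
  ∑' m : ℤ, f m • fourierLp (T := (1 : ℝ)) 2 (-m)

theorem hasSum_latticeFourier (f : EllTwo) :
    HasSum (fun m : ℤ => f m • fourierLp (T := (1 : ℝ)) 2 (-m)) (latticeFourier f) := by
  have hmem : Memℓp (fun m : ℤ => f (-m)) 2 := by
    have h := lp.memℓp f
    rw [memℓp_gen_iff (by norm_num)] at h ⊢
    exact (Equiv.neg ℤ).summable_iff.mpr h
  have h := (fourierBasis (T := (1 : ℝ))).hasSum_repr_symm
    (⟨fun m : ℤ => f (-m), hmem⟩ : EllTwo)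
  have h2 := (Equiv.neg ℤ).hasSum_iff.mpr h
  refine Summable.hasSum ⟨_, h2.congr_fun ?_⟩
  intro m
  simp [Function.comp]

/-- The frequency projection `f_D = (f̂ · 1_D)^∨` of `f` onto `D ⊆ 𝕋`, that is
`f_D(m) = ∫_D f̂(α) e(mα) dα`. -/
noncomputable def freqProj (D : Set UnitAddCircle) (f : EllTwo) (m : ℤ) : ℂ :=
  ∫ α in D, (fourier m α : ℂ) * latticeFourier f α ∂AddCircle.haarAddCircle

/-- The fractional part `{θ} ∈ [0, 1)` of a point `θ` of `𝕋 = ℝ/ℤ`. -/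
noncomputable def circleFract (θ : UnitAddCircle) : ℝ :=
  (AddCircle.equivIco 1 0 θ : ℝ)

theorem circleFract_coe (x : ℝ) : circleFract (x : UnitAddCircle) = Int.fract x := by
  simp [circleFract, AddCircle.coe_equivIco_mk_apply]

/-- `R_s`: the rationals `a/q ∈ [0, 1)` in lowest terms with `2^s ≤ q < 2^(s+1)`.
In particular `R_0 = {0}`. -/
def rationalLevel (s : ℕ) : Set ℚ :=
  {r | 0 ≤ r ∧ r < 1 ∧ 2 ^ s ≤ r.den ∧ r.den < 2 ^ (s + 1)}

/-- The single `n`-major arc at `r = a/q`: the `α` with `|{b_d α} - a/q| < 2^{-n(d-δ)}`, where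
`d` is the degree and `b_d` the leading coefficient of `P`. At `r = 0` the distance is taken on
the circle (`‖θ‖` is the distance from `θ` to the nearest integer). -/
noncomputable def majorArcAt (P : ℤ[X]) (δ : ℝ) (n : ℕ) (r : ℚ) : Set UnitAddCircle :=
  {α | (if r = 0 then ‖P.leadingCoeff • α‖ else |circleFract (P.leadingCoeff • α) - (r : ℝ)|)
    < (2 : ℝ) ^ (-((n : ℝ) * ((P.natDegree : ℝ) - δ)))}

/-- The `n`-major arcs: the union of the arcs at `a/q ∈ R_s` over all integers
`0 ≤ s ≤ nδ`. -/
noncomputable def majorArcs (P : ℤ[X]) (δ : ℝ) (n : ℕ) : Set UnitAddCircle :=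
  ⋃ (s : ℕ) (_ : (s : ℝ) ≤ (n : ℝ) * δ) (r : ℚ) (_ : r ∈ rationalLevel s), majorArcAt P δ n r

/-- The polynomial mean `K_t * g (x) = (1/t) ∑_{m = 1}^t g(x + P(m))`. -/
noncomputable def polyMean (P : ℤ[X]) (t : ℕ) (g : ℤ → ℂ) (x : ℤ) : ℂ :=
  (1 / (t : ℂ)) * ∑ m ∈ Finset.Icc 1 t, g (x + P.eval (m : ℤ))

/-- The `r`-variation `𝒱^r(a_t : t ∈ I)`: the supremum over all finite increasing sequences
`u_0 < ⋯ < u_K` in `I` of `(∑_k |a_{u_k} - a_{u_{k+1}}|^r)^{1/r}`. -/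
noncomputable def variation (r : ℝ) (I : Set ℕ) (a : ℕ → ℂ) : ℝ≥0∞ :=
  ⨆ (K : ℕ) (u : Fin (K + 1) → ℕ) (_ : StrictMono u ∧ ∀ k, u k ∈ I),
    (∑ k : Fin K, ‖a (u k.castSucc) - a (u k.succ)‖ₑ ^ r) ^ (1 / r)

/-- The short `2`-variation `𝒱²_n(K_t * g)(x) = 𝒱²(K_t * g (x) : 2^n ≤ t ≤ 2^(n+1))`. -/
noncomputable def shortVariation (P : ℤ[X]) (n : ℕ) (g : ℤ → ℂ) (x : ℤ) : ℝ≥0∞ :=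
  variation 2 (Set.Icc (2 ^ n) (2 ^ (n + 1))) (fun t => polyMean P t g x)

/-- The squared `ℓ²(ℤ)` norm of a `[0, ∞]`-valued function. -/
noncomputable def ellTwoNormSq (V : ℤ → ℝ≥0∞) : ℝ≥0∞ := ∑' x : ℤ, V x ^ 2

end PolyVariation

/-! The short variation is first replaced by a quadratic quantity. Chaining along dyadic grids
bounds its square by 24 times `dyadicEnergy`, a weighted sum of squared increments
(`variation_two_sq_le_dyadicEnergy`). The energy is quadratic, so Plancherel moves it to the
multipliers: with m_t(α) = (1/t) ∑ e(P(m)α) and E_n(α) the energy of t ↦ m_t(α) over the n-th block,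
everything follows from the pointwise bound ∑_n 1_{𝔐_n}(α) E_n(α) ≤ C
(`exists_tsum_dyadicEnergy_le`).

Let α lie in the arc at a/q of level s, let b be the leading coefficient of P and d = e + 1 its
degree. Then α = A/(bq) + η with A ≡ a mod q and η tiny, and m_t(α) equals a Gauss sum times m_t(η),
up to a power of 2^{-n} (`norm_expMean_add_sub_le`). Weyl differencing bounds the Gauss sum by
q^{-κ} (`exists_norm_sum_stdAddChar_le`, `exists_norm_gaussMean_le`), which is a geometric gain in
s. The energy of m_t(η) is governed by X = |η| 2^{nd}: the phase is nearly constant for small X and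
cancels for large X, so the energy is at most a constant times min(X, 1/X)^p for some p > 0
(`exists_dyadicEnergy_expMean_le_decayProfile`).

At fixed α and s, separation of fractions leaves at most one candidate a/q for all large n
(`eq_of_mem_rationalLevel`). The sum over n of min(X, 1/X)^p is then a two-sided geometric series
bounded uniformly in η, and the sum over s converges by the Gauss sum gain. -/

namespace PolyVariation

/-! ### Chaining: the short variation against the dyadic energy -/

/-- Weighted sum of the squared increments of `a` on `[2^n, 2^(n+1)]` along the dyadic grids. -/
noncomputable def dyadicEnergy (n : ℕ) (a : ℕ → ℂ) : ℝ :=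
  ∑ l ∈ Finset.range (n + 1), (6 / 5 : ℝ) ^ l * ∑ j ∈ Finset.range (2 ^ l + 1),
    ‖a (2 ^ n + 2 ^ (n - l) * j) - a (2 ^ n + 2 ^ (n - l) * (2 * (j / 2)))‖ ^ 2

theorem dyadicEnergy_nonneg (n : ℕ) (a : ℕ → ℂ) : 0 ≤ dyadicEnergy n a :=
  Finset.sum_nonneg fun _ _ => mul_nonneg (by positivity)
    (Finset.sum_nonneg fun _ _ => by positivity)

/-- Each visited index enters at most two nonzero increments, and each of them charges it 2‖F j‖².
The subtracted term is the unspent charge of the last index; it closes the induction. -/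
theorem sum_sq_sub_le_of_monotone (F : ℕ → ℂ) {v : ℕ → ℕ} (hv : Monotone v) (K : ℕ) :
    ∑ k ∈ Finset.range K, ‖F (v (k + 1)) - F (v k)‖ ^ 2
      ≤ 4 * ∑ j ∈ Finset.range (v K + 1), ‖F j‖ ^ 2 - 2 * ‖F (v K)‖ ^ 2 := by
  induction K with
  | zero =>
    rw [Finset.sum_range_succ]
    have : 0 ≤ ∑ j ∈ Finset.range (v 0), ‖F j‖ ^ 2 := by positivity
    have h2 : 0 ≤ ‖F (v 0)‖ ^ 2 := by positivity
    simp only [Finset.range_zero, Finset.sum_empty]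
    linarith
  | succ K ih =>
    rw [Finset.sum_range_succ]
    rcases (hv (Nat.le_succ K)).eq_or_lt with h | h
    · rw [Nat.succ_eq_add_one] at h
      rw [← h]; simpa using ih
    · have h1 : ∑ j ∈ Finset.range (v K + 1), ‖F j‖ ^ 2
          ≤ ∑ j ∈ Finset.range (v (K + 1)), ‖F j‖ ^ 2 :=
        Finset.sum_le_sum_of_subset_of_nonneg (Finset.range_mono h) fun _ _ _ => by positivity
      rw [Finset.sum_range_succ _ (v (K + 1))]
      have h2 : ‖F (v (K + 1)) - F (v K)‖ ^ 2 ≤ 2 * ‖F (v (K + 1))‖ ^ 2 + 2 * ‖F (v K)‖ ^ 2 := by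
        have := norm_sub_le (F (v (K + 1))) (F (v K))
        nlinarith [norm_nonneg (F (v (K + 1)) - F (v K)),
          sq_nonneg (‖F (v (K + 1))‖ - ‖F (v K)‖)]
      linarith

/-- Cauchy–Schwarz against the weights (5/6)^l, whose full sum is 6. -/
theorem sq_norm_sum_le_weighted (n : ℕ) (x : ℕ → ℂ) :
    ‖∑ l ∈ Finset.range n, x l‖ ^ 2 ≤ 6 * ∑ l ∈ Finset.range n, (6 / 5 : ℝ) ^ l * ‖x l‖ ^ 2 := by
  have hg : ∑ l ∈ Finset.range n, (5 / 6 : ℝ) ^ l ≤ 6 := by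
    have := Summable.sum_le_tsum (Finset.range n) (fun i _ => by positivity)
      (summable_geometric_of_lt_one (by norm_num : (0 : ℝ) ≤ 5 / 6) (by norm_num))
    rw [tsum_geometric_of_lt_one (by norm_num) (by norm_num)] at this
    norm_num at this ⊢
    exact this
  have hcs := Finset.sum_sq_le_sum_mul_sum_of_sq_le_mul (Finset.range n)
    (r := fun l => ‖x l‖) (f := fun l => (5 / 6 : ℝ) ^ l)
    (g := fun l => (6 / 5 : ℝ) ^ l * ‖x l‖ ^ 2)
    (fun _ _ => by positivity) (fun _ _ => by positivity) (fun l _ => by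
      rw [← mul_assoc, ← mul_pow]; norm_num)
  have h0 : 0 ≤ ∑ l ∈ Finset.range n, (6 / 5 : ℝ) ^ l * ‖x l‖ ^ 2 :=
    Finset.sum_nonneg fun _ _ => by positivity
  calc _ ≤ (∑ l ∈ Finset.range n, ‖x l‖) ^ 2 := by gcongr; exact norm_sum_le _ _
    _ ≤ _ := hcs
    _ ≤ _ := by gcongr

/-- Writing r in binary telescopes `a (2 ^ n + r) - a (2 ^ n)` into one dyadic increment per level,
by truncating r to multiples of 2^(n-l). At each level the truncations of a monotone sequence are
monotone, so each grid increment is counted a bounded number of times. The constant is 24 = 6 · 4.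
-/
theorem sum_sq_increments_le_dyadicEnergy (n : ℕ) (a : ℕ → ℂ) {u : ℕ → ℕ} (hu : Monotone u)
    (hmem : ∀ k, u k ∈ Set.Icc (2 ^ n) (2 ^ (n + 1))) (K : ℕ) :
    ∑ k ∈ Finset.range K, ‖a (u k) - a (u (k + 1))‖ ^ 2 ≤ 24 * dyadicEnergy n a := by
  set G : ℕ → ℕ → ℂ := fun l j =>
    a (2 ^ n + 2 ^ (n - l) * j) - a (2 ^ n + 2 ^ (n - l) * (2 * (j / 2))) with hG
  have htel : ∀ r ≤ 2 ^ n, ∑ l ∈ Finset.range (n + 1), G l (r / 2 ^ (n - l))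
      = a (2 ^ n + r) - a (2 ^ n) := by
    intro r hr
    rw [← Finset.sum_range_reflect]
    have h1 : ∀ i ∈ Finset.range (n + 1), G (n + 1 - 1 - i) (r / 2 ^ (n - (n + 1 - 1 - i)))
        = a (2 ^ n + 2 ^ i * (r / 2 ^ i)) - a (2 ^ n + 2 ^ (i + 1) * (r / 2 ^ (i + 1))) := by
      intro i hi
      have hi' : i ≤ n := by simpa [Nat.lt_succ_iff] using hi
      have : n - (n + 1 - 1 - i) = i := by omega
      simp only [hG, this]
      rw [Nat.div_div_eq_div_mul, ← pow_succ, ← mul_assoc, ← pow_succ]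
    rw [Finset.sum_congr rfl h1, Finset.sum_range_sub']
    -- The coarsest truncation has step 2^(n+1) > r, so the telescoping ends exactly at `a (2 ^ n)`;
    -- this also covers the endpoint r = 2^n.
    have : r / 2 ^ (n + 1) = 0 := Nat.div_eq_of_lt (by rw [pow_succ]; have := Nat.one_le_two_pow (n := n); omega)
    simp [this]
  set r : ℕ → ℕ := fun k => u k - 2 ^ n with hr
  have hr2 : ∀ k, r k ≤ 2 ^ n := fun k => by
    have := (hmem k).2; rw [pow_succ] at this; simp only [hr]; omega
  have hru : ∀ k, u k = 2 ^ n + r k := fun k => by have := (hmem k).1; simp only [hr]; omega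
  have hrm : Monotone r := fun i j hij => by have := hu hij; simp only [hr]; omega
  have hdiff : ∀ k, ‖a (u k) - a (u (k + 1))‖ ^ 2 ≤ 6 * ∑ l ∈ Finset.range (n + 1),
      (6 / 5 : ℝ) ^ l * ‖G l (r (k + 1) / 2 ^ (n - l)) - G l (r k / 2 ^ (n - l))‖ ^ 2 := by
    intro k
    refine le_trans (le_of_eq ?_) (sq_norm_sum_le_weighted (n + 1) _)
    rw [Finset.sum_sub_distrib, htel _ (hr2 _), htel _ (hr2 _), hru k, hru (k + 1), ← norm_neg]
    congr 2; ring
  calc _ ≤ ∑ k ∈ Finset.range K, 6 * ∑ l ∈ Finset.range (n + 1),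
      (6 / 5 : ℝ) ^ l * ‖G l (r (k + 1) / 2 ^ (n - l)) - G l (r k / 2 ^ (n - l))‖ ^ 2 :=
        Finset.sum_le_sum fun k _ => hdiff k
    _ = 6 * ∑ l ∈ Finset.range (n + 1), (6 / 5 : ℝ) ^ l * ∑ k ∈ Finset.range K,
      ‖G l (r (k + 1) / 2 ^ (n - l)) - G l (r k / 2 ^ (n - l))‖ ^ 2 := by
        rw [← Finset.mul_sum, Finset.sum_comm]
        simp_rw [Finset.mul_sum]
    _ ≤ 6 * ∑ l ∈ Finset.range (n + 1), (6 / 5 : ℝ) ^ l *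
        (4 * ∑ j ∈ Finset.range (2 ^ l + 1), ‖G l j‖ ^ 2) := by
        gcongr with l hl
        have hl' : l ≤ n := by simpa [Nat.lt_succ_iff] using hl
        have := sum_sq_sub_le_of_monotone (G l) (v := fun k => r k / 2 ^ (n - l))
          (fun i j hij => Nat.div_le_div_right (hrm hij)) K
        have h2 : r K / 2 ^ (n - l) ≤ 2 ^ l := by
          refine (Nat.div_le_div_right (hr2 K)).trans ?_
          rw [Nat.pow_div (by omega) (by norm_num)]
          have : n - (n - l) = l := by omega
          rw [this]
        have h3 : ∑ j ∈ Finset.range (r K / 2 ^ (n - l) + 1), ‖G l j‖ ^ 2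
          ≤ ∑ j ∈ Finset.range (2 ^ l + 1), ‖G l j‖ ^ 2 :=
          Finset.sum_le_sum_of_subset_of_nonneg (Finset.range_mono (by omega))
            fun _ _ _ => by positivity
        have h4 : 0 ≤ ‖G l (r K / 2 ^ (n - l))‖ ^ 2 := by positivity
        linarith
    _ = _ := by
        simp only [dyadicEnergy, hG, Finset.mul_sum]
        refine Finset.sum_congr rfl fun l _ => Finset.sum_congr rfl fun j _ => ?_
        ring

theorem variation_two_sq_le_dyadicEnergy (n : ℕ) (a : ℕ → ℂ) :
    variation 2 (Set.Icc (2 ^ n) (2 ^ (n + 1))) a ^ 2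
      ≤ ENNReal.ofReal (24 * dyadicEnergy n a) := by
  have key : variation 2 (Set.Icc (2 ^ n) (2 ^ (n + 1))) a
      ≤ ENNReal.ofReal (24 * dyadicEnergy n a) ^ (1 / 2 : ℝ) := by
    refine iSup_le fun K => iSup_le fun u => iSup_le fun hu => ?_
    refine ENNReal.rpow_le_rpow ?_ (by norm_num)
    -- The sequence is continued by its last value, so that it becomes monotone on all of ℕ.
    set v : ℕ → ℕ := fun k => u ⟨min k K, by omega⟩ with hv
    have hvm : Monotone v := fun i j hij => hu.1.monotone (by
      simp only [Fin.mk_le_mk]; omega)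
    have hb := sum_sq_increments_le_dyadicEnergy n a hvm (fun k => hu.2 _) K
    refine le_trans (le_of_eq ?_) (ENNReal.ofReal_le_ofReal hb)
    rw [ENNReal.ofReal_sum_of_nonneg (fun _ _ => by positivity), Finset.sum_range]
    refine Finset.sum_congr rfl fun k _ => ?_
    have h1 : v k = u k.castSucc := by
      simp only [hv]; congr 1; ext; simp
    have h2 : v (k + 1) = u k.succ := by
      simp only [hv]; congr 1; ext; simp
    rw [h1, h2, ENNReal.ofReal_pow (norm_nonneg _), ofReal_norm]
    norm_num
  calc _ ≤ (ENNReal.ofReal (24 * dyadicEnergy n a) ^ (1 / 2 : ℝ)) ^ 2 := by gcongr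
    _ = _ := by
      rw [← ENNReal.rpow_natCast, ← ENNReal.rpow_mul]; norm_num

/-! ### Weyl's bound for complete exponential sums -/

theorem card_filter_mul_eq_zero_mul_addOrderOf {N : ℕ} [NeZero N] (y : ZMod N) :
    (Finset.univ.filter fun h : ZMod N => h * y = 0).card * addOrderOf y = N := by
  set φ : ZMod N →+ ZMod N := AddMonoidHom.mulRight y with hφ
  have h1 : Nat.card φ.range = addOrderOf y := by
    rw [← Nat.card_zmultiples]
    congr 2
    ext z
    simp only [AddMonoidHom.mem_range, AddSubgroup.mem_zmultiples_iff, hφ,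
      AddMonoidHom.coe_mulRight, zsmul_eq_mul]
    constructor
    · rintro ⟨x, rfl⟩
      exact ⟨x.val, by simp⟩
    · rintro ⟨k, rfl⟩
      exact ⟨k, rfl⟩
  have h2 : Nat.card φ.ker = (Finset.univ.filter fun h : ZMod N => h * y = 0).card := by
    rw [Nat.card_eq_fintype_card, ← Fintype.card_subtype]
    refine Fintype.card_congr (Equiv.subtypeEquivRight fun x => ?_)
    simp [AddMonoidHom.mem_ker, hφ]
  have h3 := AddSubgroup.card_eq_card_quotient_mul_card_addSubgroup φ.ker
  rw [Nat.card_congr (QuotientAddGroup.quotientKerEquivRange φ).toEquiv, h1, h2,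
    Nat.card_zmod] at h3
  rw [mul_comm]; exact h3.symm

theorem addOrderOf_le_mul_addOrderOf_nsmul {A : Type*} [AddGroup A] [Finite A] (n : ℕ)
    (hn : 0 < n) (x : A) : addOrderOf x ≤ n * addOrderOf (n • x) := by
  refine addOrderOf_le_of_nsmul_eq_zero (by have := addOrderOf_pos (n • x); positivity) ?_
  rw [mul_nsmul, addOrderOf_nsmul_eq_zero]

/-- Counts the bad shifts in Weyl differencing. If h c has order g ≤ T, then h annihilates g c,
whose annihilator has N / ord(g c) ≤ N g / ord(c) elements; summing over g ≤ T costs T². -/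
theorem card_filter_addOrderOf_mul_le {N : ℕ} [NeZero N] (c : ZMod N) (T : ℕ) :
    (Finset.univ.filter fun h : ZMod N => addOrderOf (h * c) ≤ T).card * addOrderOf c
      ≤ N * T ^ 2 := by
  have hsub : (Finset.univ.filter fun h : ZMod N => addOrderOf (h * c) ≤ T) ⊆
      (Finset.Icc 1 T).biUnion fun g => Finset.univ.filter fun h : ZMod N => h * (g • c) = 0 := by
    intro h hh
    simp only [Finset.mem_filter, Finset.mem_univ, true_and, Finset.mem_biUnion,
      Finset.mem_Icc] at hh ⊢
    refine ⟨addOrderOf (h * c), ⟨addOrderOf_pos _, hh⟩, ?_⟩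
    rw [mul_smul_comm, addOrderOf_nsmul_eq_zero]
  have hcard := (Finset.card_le_card hsub).trans Finset.card_biUnion_le
  calc _ ≤ (∑ g ∈ Finset.Icc 1 T,
        (Finset.univ.filter fun h : ZMod N => h * (g • c) = 0).card) * addOrderOf c := by gcongr
    _ ≤ ∑ g ∈ Finset.Icc 1 T, N * T := by
      rw [Finset.sum_mul]
      refine Finset.sum_le_sum fun g hg => ?_
      rw [Finset.mem_Icc] at hg
      calc _ ≤ (Finset.univ.filter fun h : ZMod N => h * (g • c) = 0).card *
            (g * addOrderOf (g • c)) := by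
            gcongr; exact addOrderOf_le_mul_addOrderOf_nsmul g hg.1 c
        _ = N * g := by
          rw [mul_left_comm, card_filter_mul_eq_zero_mul_addOrderOf, mul_comm]
        _ ≤ N * T := by gcongr; exact hg.2
    _ = N * T ^ 2 := by simp; ring

theorem coeff_taylor_sub_self {R : Type*} [CommRing R] (F : R[X]) (d : ℕ)
    (hF : F.natDegree ≤ d + 1) (h : R) :
    (Polynomial.taylor h F - F).natDegree ≤ d ∧
      (Polynomial.taylor h F - F).coeff d = (d + 1) • (h * F.coeff (d + 1)) := by
  constructor
  · rw [Polynomial.natDegree_le_iff_coeff_eq_zero]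
    intro k hk
    rw [Polynomial.coeff_sub, Polynomial.taylor_coeff]
    have hdeg : (Polynomial.hasseDeriv k F).natDegree ≤ 0 := by
      refine (Polynomial.natDegree_hasseDeriv_le F k).trans ?_
      omega
    rw [Polynomial.eq_C_of_natDegree_le_zero hdeg, Polynomial.hasseDeriv_coeff]
    simp
  · rw [Polynomial.coeff_sub, Polynomial.taylor_coeff]
    have hdeg : (Polynomial.hasseDeriv d F).natDegree < 2 := by
      refine (Polynomial.natDegree_hasseDeriv_le F d).trans_lt ?_
      omega
    rw [Polynomial.eval_eq_sum_range' hdeg]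
    simp [Finset.sum_range_succ, Polynomial.hasseDeriv_coeff, add_comm 1 d]
    ring

/-- Weyl differencing: expand the square and substitute y = x + h. The differenced polynomial has
lower degree by `coeff_taylor_sub_self`. -/
theorem norm_sq_sum_stdAddChar_le {N : ℕ} [NeZero N] (F : (ZMod N)[X]) :
    ‖∑ x : ZMod N, ZMod.stdAddChar (F.eval x)‖ ^ 2 ≤
      ∑ h : ZMod N, ‖∑ x : ZMod N,
        ZMod.stdAddChar ((Polynomial.taylor h F - F).eval x)‖ := by
  have h1 : ((‖∑ x : ZMod N, ZMod.stdAddChar (F.eval x)‖ ^ 2 : ℝ) : ℂ) =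
      ∑ h : ZMod N, ∑ x : ZMod N, ZMod.stdAddChar ((Polynomial.taylor h F - F).eval x) := by
    push_cast
    rw [← Complex.conj_mul', map_sum, Finset.sum_mul_sum]
    symm
    rw [Finset.sum_comm]
    refine Finset.sum_congr rfl fun x _ => ?_
    rw [← Equiv.sum_comp (Equiv.addLeft x) (fun y => _ * _)]
    refine Finset.sum_congr rfl fun h _ => ?_
    simp [Polynomial.taylor_eval, sub_eq_add_neg, AddChar.map_add_eq_mul, AddChar.map_neg_eq_conj, mul_comm]
  calc _ = ‖((‖∑ x : ZMod N, ZMod.stdAddChar (F.eval x)‖ ^ 2 : ℝ) : ℂ)‖ := by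
        rw [Complex.norm_real]; simp
    _ ≤ _ := by rw [h1]; exact norm_sum_le _ _

theorem norm_sum_stdAddChar_le_card {N : ℕ} [NeZero N] (F : (ZMod N)[X]) :
    ‖∑ x : ZMod N, ZMod.stdAddChar (F.eval x)‖ ≤ N := by
  refine (norm_sum_le _ _).trans ?_
  simp [AddChar.norm_apply]

/-- Power decay of complete exponential sums in the reduced denominator of the leading
coefficient. -/
theorem exists_norm_sum_stdAddChar_le (d : ℕ) (hd : 1 ≤ d) :
    ∃ κ C : ℝ, 0 < κ ∧ κ ≤ 1 ∧ 1 ≤ C ∧ ∀ (N : ℕ) [NeZero N] (F : (ZMod N)[X]),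
      F.natDegree ≤ d → ‖∑ x : ZMod N, ZMod.stdAddChar (F.eval x)‖
        ≤ C * N * (addOrderOf (F.coeff d) : ℝ) ^ (-κ) := by
  induction d, hd using Nat.le_induction with
  | base =>
    refine ⟨1, 1, one_pos, le_rfl, le_rfl, fun N _ F hF => ?_⟩
    by_cases hc : F.coeff 1 = 0
    · rw [hc]
      simpa using norm_sum_stdAddChar_le_card F
    · have h0 : ∑ x : ZMod N, ZMod.stdAddChar (F.eval x) = 0 := by
        have hev : ∀ x, ZMod.stdAddChar (F.eval x) =
            ZMod.stdAddChar (F.coeff 0) * ZMod.stdAddChar (x * F.coeff 1) := fun x => by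
          rw [Polynomial.eval_eq_sum_range' (Nat.lt_succ_of_le hF), ← AddChar.map_add_eq_mul]
          simp [Finset.sum_range_succ, mul_comm]
        simp_rw [hev]
        rw [← Finset.mul_sum, AddChar.sum_mulShift _ (ZMod.isPrimitive_stdAddChar N), if_neg hc]
        simp
      rw [h0, norm_zero]
      positivity
  | succ d hd ih =>
    obtain ⟨κ, C, hκ, hκ1, hC, hb⟩ := ih
    -- With q the order of the leading coefficient, the good shifts contribute q^{-κ/3} to the
    -- squared sum, and the square root halves the exponent. The summand 1 pays for the bad shifts.
    refine ⟨κ / 6, C * (d + 1) + 1, by positivity, by linarith, ?_, fun N _ F hF => ?_⟩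
    · have : 0 ≤ C * (d + 1) := by positivity
      linarith
    set c := F.coeff (d + 1) with hc
    set q : ℝ := (addOrderOf c : ℝ) with hq
    have hq1 : 1 ≤ q := by rw [hq]; exact_mod_cast addOrderOf_pos c
    have hq0 : 0 < q := by linarith
    have hN : (0 : ℝ) < N := by exact_mod_cast Nat.pos_of_ne_zero (NeZero.ne N)
    -- The bad shifts have density at most T²/q ≤ q^{-1/3}, while for the others h c still has order
    -- above q^{1/3}.
    set T : ℕ := ⌊q ^ (1 / 3 : ℝ)⌋₊ with hT
    set B : Finset (ZMod N) := Finset.univ.filter fun h : ZMod N => addOrderOf (h * c) ≤ T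
    have hB : (B.card : ℝ) ≤ N * q ^ (-(1 / 3) : ℝ) := by
      have h1 : (B.card : ℝ) * q ≤ N * (T : ℝ) ^ 2 := by
        rw [hq]; exact_mod_cast card_filter_addOrderOf_mul_le c T
      have h2 : (T : ℝ) ^ 2 ≤ q ^ (2 / 3 : ℝ) := by
        have : (T : ℝ) ≤ q ^ (1 / 3 : ℝ) := Nat.floor_le (by positivity)
        calc (T : ℝ) ^ 2 ≤ (q ^ (1 / 3 : ℝ)) ^ 2 := by gcongr
          _ = _ := by rw [← Real.rpow_natCast, ← Real.rpow_mul hq0.le]; norm_num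
      have h3 : q ^ (-(1 / 3) : ℝ) * q = q ^ (2 / 3 : ℝ) := by
        rw [← Real.rpow_add_one hq0.ne']; norm_num
      refine le_of_mul_le_mul_right ?_ hq0
      calc _ ≤ N * (T : ℝ) ^ 2 := h1
        _ ≤ N * q ^ (2 / 3 : ℝ) := by gcongr
        _ = _ := by rw [← h3]; ring
    have hgood : ∀ h : ZMod N, h ∉ B → ‖∑ x : ZMod N,
        ZMod.stdAddChar ((Polynomial.taylor h F - F).eval x)‖
          ≤ C * (d + 1) * N * q ^ (-(κ / 3)) := by
      intro h hh
      obtain ⟨h1, h2⟩ := coeff_taylor_sub_self F d hF h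
      refine (hb N _ h1).trans ?_
      rw [h2]
      have h3 : q ^ (1 / 3 : ℝ) < addOrderOf (h * c) := by
        simp only [B, Finset.mem_filter, Finset.mem_univ, true_and, not_le] at hh
        exact Nat.lt_of_floor_lt hh
      have h4 : (addOrderOf (h * c) : ℝ) ≤ (d + 1) * addOrderOf ((d + 1) • (h * c)) := by
        exact_mod_cast addOrderOf_le_mul_addOrderOf_nsmul (d + 1) (by omega) (h * c)
      have h5 : q ^ (1 / 3 : ℝ) / (d + 1) ≤ addOrderOf ((d + 1) • (h * c)) := by
        rw [div_le_iff₀ (by positivity)]; linarith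
      have h6 : (addOrderOf ((d + 1) • (h * c)) : ℝ) ^ (-κ) ≤ (d + 1) * q ^ (-(κ / 3)) := by
        calc _ ≤ (q ^ (1 / 3 : ℝ) / (d + 1)) ^ (-κ) :=
              Real.rpow_le_rpow_of_nonpos (by positivity) h5 (by linarith)
          _ = ((d : ℝ) + 1) ^ κ * q ^ (-(κ / 3)) := by
            rw [Real.div_rpow (by positivity) (by positivity), ← Real.rpow_mul hq0.le,
              Real.rpow_neg (by positivity : (0 : ℝ) ≤ d + 1), div_inv_eq_mul, mul_comm]
            congr 2; ring
          _ ≤ ((d : ℝ) + 1) ^ (1 : ℝ) * q ^ (-(κ / 3)) := by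
            gcongr
            have : (0 : ℝ) ≤ d := Nat.cast_nonneg d
            linarith
          _ = _ := by rw [Real.rpow_one]
      calc _ ≤ C * N * ((d + 1) * q ^ (-(κ / 3))) := by gcongr
        _ = _ := by ring
    have hexp : q ^ (-(1 / 3) : ℝ) ≤ q ^ (-(κ / 3)) :=
      Real.rpow_le_rpow_of_exponent_le hq1 (by linarith)
    have hsq : ‖∑ x : ZMod N, ZMod.stdAddChar (F.eval x)‖ ^ 2
        ≤ (C * (d + 1) + 1) * (N ^ 2 * q ^ (-(κ / 3))) := by
      refine (norm_sq_sum_stdAddChar_le F).trans ?_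
      rw [← Finset.sum_filter_add_sum_filter_not Finset.univ (fun h => h ∈ B)]
      have e1 : ∑ h ∈ Finset.univ.filter (fun h => h ∈ B), ‖∑ x : ZMod N,
          ZMod.stdAddChar ((Polynomial.taylor h F - F).eval x)‖
            ≤ N * q ^ (-(κ / 3)) * N := by
        calc _ ≤ ∑ h ∈ Finset.univ.filter (fun h => h ∈ B), (N : ℝ) :=
              Finset.sum_le_sum fun h _ => norm_sum_stdAddChar_le_card _
          _ = B.card * N := by simp
          _ ≤ N * q ^ (-(1 / 3) : ℝ) * N := by gcongr
          _ ≤ _ := by gcongr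
      have e2 : ∑ h ∈ Finset.univ.filter (fun h => h ∉ B), ‖∑ x : ZMod N,
          ZMod.stdAddChar ((Polynomial.taylor h F - F).eval x)‖
            ≤ N * (C * (d + 1) * N * q ^ (-(κ / 3))) := by
        calc _ ≤ ∑ h ∈ Finset.univ.filter (fun h => h ∉ B), C * (d + 1) * N * q ^ (-(κ / 3)) :=
              Finset.sum_le_sum fun h hh => hgood h (by simpa using hh)
          _ ≤ ∑ h : ZMod N, C * (d + 1) * N * q ^ (-(κ / 3)) :=
              Finset.sum_le_sum_of_subset_of_nonneg (Finset.filter_subset _ _)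
                fun _ _ _ => by positivity
          _ = _ := by simp
      nlinarith
    refine le_of_sq_le_sq ?_ (by positivity)
    refine hsq.trans ?_
    have hq3 : (q ^ (-(κ / 6))) ^ 2 = q ^ (-(κ / 3)) := by
      rw [← Real.rpow_natCast, ← Real.rpow_mul hq0.le]; congr 1; push_cast; ring
    rw [mul_pow, mul_pow, hq3]
    have hC1 : 1 ≤ C * (d + 1) + 1 := by
      have : 0 ≤ C * (d + 1) := by positivity
      linarith
    rw [mul_assoc]
    gcongr
    nlinarith

/-! ### Exponential means and their approximation near rationals -/

/-- `e(x) = exp(2πix)`. -/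
noncomputable def expo (x : ℝ) : ℂ := Complex.exp (Complex.I * ((2 * Real.pi * x : ℝ) : ℂ))

theorem norm_expo (x : ℝ) : ‖expo x‖ = 1 := Complex.norm_exp_I_mul_ofReal _

theorem expo_add (x y : ℝ) : expo (x + y) = expo x * expo y := by
  simp only [expo, ← Complex.exp_add]; congr 1; push_cast; ring

theorem norm_expo_sub_one_le (x : ℝ) : ‖expo x - 1‖ ≤ 2 * Real.pi * |x| := by
  refine Real.norm_exp_I_mul_ofReal_sub_one_le.trans (le_of_eq ?_)
  rw [Real.norm_eq_abs, abs_mul, abs_of_pos Real.two_pi_pos]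

theorem norm_expo_sub_le (x y : ℝ) : ‖expo x - expo y‖ ≤ 2 * Real.pi * |x - y| := by
  have : expo x - expo y = expo y * (expo (x - y) - 1) := by
    rw [mul_sub, ← expo_add]; simp
  rw [this, norm_mul, norm_expo, one_mul]
  exact norm_expo_sub_one_le _

theorem le_norm_expo_sub_one {x : ℝ} (hx : |x| ≤ 1 / 2) : 4 * |x| ≤ ‖expo x - 1‖ := by
  rw [expo, Complex.norm_exp_I_mul_ofReal_sub_one, Real.norm_eq_abs, abs_mul, abs_two]
  have h1 : |Real.sin (2 * Real.pi * x / 2)| = Real.sin (Real.pi * |x|) := by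
    have e : 2 * Real.pi * x / 2 = Real.pi * x := by ring
    rw [e]
    have hpos : 0 ≤ Real.sin (Real.pi * |x|) :=
      Real.sin_nonneg_of_nonneg_of_le_pi (by positivity) (by nlinarith [Real.pi_pos])
    rcases abs_cases x with ⟨h, _⟩ | ⟨h, _⟩ <;> rw [h] at hpos ⊢
    · exact abs_of_nonneg hpos
    · rw [← abs_of_nonneg hpos, mul_neg, Real.sin_neg, abs_neg]
  rw [h1]
  have := Real.mul_le_sin (x := Real.pi * |x|) (by positivity) (by nlinarith [Real.pi_pos])
  have h2 : 2 / Real.pi * (Real.pi * |x|) = 2 * |x| := by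
    field_simp
  linarith

/-- The mean `(z 1 + ⋯ + z t) / t`. -/
noncomputable def natAvg (z : ℕ → ℂ) (t : ℕ) : ℂ := (1 / (t : ℂ)) * ∑ i ∈ Finset.range t, z (i + 1)

theorem natAvg_const (c : ℂ) {t : ℕ} (ht : 1 ≤ t) : natAvg (fun _ => c) t = c := by
  have : (t : ℂ) ≠ 0 := by exact_mod_cast (by omega : t ≠ 0)
  simp [natAvg]; field_simp

theorem natAvg_sub (z w : ℕ → ℂ) (t : ℕ) :
    natAvg (fun m => z m - w m) t = natAvg z t - natAvg w t := by
  simp [natAvg, Finset.sum_sub_distrib, mul_sub]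

theorem norm_natAvg_le {z : ℕ → ℂ} {B : ℝ} {t : ℕ} (ht : 1 ≤ t)
    (hz : ∀ m, 1 ≤ m → m ≤ t → ‖z m‖ ≤ B) : ‖natAvg z t‖ ≤ B := by
  have ht0 : (0 : ℝ) < t := by exact_mod_cast ht
  rw [natAvg, norm_mul, norm_div, norm_one, Complex.norm_natCast, one_div, inv_mul_le_iff₀ ht0]
  refine (norm_sum_le _ _).trans ?_
  calc _ ≤ ∑ i ∈ Finset.range t, B := Finset.sum_le_sum fun i hi =>
        hz _ (by omega) (by simpa using hi)
    _ = _ := by simp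

theorem norm_natAvg_sub_natAvg_le {z : ℕ → ℂ} {B : ℝ} {t t' : ℕ} (ht : 1 ≤ t) (htt : t ≤ t')
    (hz : ∀ m, 1 ≤ m → m ≤ t' → ‖z m‖ ≤ B) :
    ‖natAvg z t - natAvg z t'‖ ≤ 2 * B * ((t' - t : ℝ) / t') := by
  obtain ⟨k, rfl⟩ := Nat.exists_eq_add_of_le htt
  have ht0 : (0 : ℝ) < t := by exact_mod_cast ht
  have htk : (0 : ℝ) < ((t + k : ℕ) : ℝ) := by exact_mod_cast (by omega : 0 < t + k)
  have htc : (t : ℂ) ≠ 0 := by exact_mod_cast ht0.ne'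
  have htkc : ((t + k : ℕ) : ℂ) ≠ 0 := by exact_mod_cast htk.ne'
  have hid : natAvg z t - natAvg z (t + k) = (1 / ((t + k : ℕ) : ℂ)) *
      (k * natAvg z t - ∑ i ∈ Finset.range k, z (t + i + 1)) := by
    simp only [natAvg, Finset.sum_range_add]
    field_simp
    push_cast
    ring
  have h1 : ‖natAvg z t‖ ≤ B := norm_natAvg_le ht fun m h1 h2 => hz m h1 (by omega)
  have h2 : ‖∑ i ∈ Finset.range k, z (t + i + 1)‖ ≤ k * B := by
    refine (norm_sum_le _ _).trans ?_
    calc _ ≤ ∑ i ∈ Finset.range k, B := Finset.sum_le_sum fun i hi => by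
          have := Finset.mem_range.1 hi
          exact hz _ (by omega) (by omega)
      _ = _ := by simp
  rw [hid, norm_mul, norm_div, norm_one, Complex.norm_natCast]
  have h3 : ‖(k : ℂ) * natAvg z t - ∑ i ∈ Finset.range k, z (t + i + 1)‖ ≤ 2 * B * k := by
    refine (norm_sub_le _ _).trans ?_
    rw [norm_mul, Complex.norm_natCast]
    have : (k : ℝ) * ‖natAvg z t‖ ≤ k * B := by gcongr
    linarith
  calc _ ≤ 1 / ((t + k : ℕ) : ℝ) * (2 * B * k) := by gcongr
    _ = _ := by push_cast; ring

theorem norm_sum_mul_le_of_partial_sums {w u : ℕ → ℂ} {W : ℝ} {t : ℕ}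
    (hW : ∀ k ≤ t, ‖∑ i ∈ Finset.range k, w i‖ ≤ W) :
    ‖∑ i ∈ Finset.range t, w i * u i‖
      ≤ W * (‖u t‖ + ∑ i ∈ Finset.range t, ‖u (i + 1) - u i‖) := by
  have hid : ∀ k, ∑ i ∈ Finset.range k, w i * u i = (∑ i ∈ Finset.range k, w i) * u k -
      ∑ i ∈ Finset.range k, (∑ j ∈ Finset.range (i + 1), w j) * (u (i + 1) - u i) := by
    intro k
    induction k with
    | zero => simp
    | succ k ih =>
      rw [Finset.sum_range_succ, ih, Finset.sum_range_succ (fun i => _ * (u (i + 1) - u i)),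
        Finset.sum_range_succ w]
      ring
  rw [hid t, mul_add, Finset.mul_sum]
  refine (norm_sub_le _ _).trans (add_le_add ?_ ((norm_sum_le _ _).trans ?_))
  · rw [norm_mul]; gcongr; exact hW t le_rfl
  · refine Finset.sum_le_sum fun i hi => ?_
    rw [norm_mul]; gcongr; exact hW _ (Finset.mem_range.1 hi)

theorem norm_sum_range_le_of_periodic {w : ℕ → ℂ} {N : ℕ} (hN : 1 ≤ N)
    (hper : ∀ i, w (N + i) = w i) (hsum : ∑ i ∈ Finset.range N, w i = 0)
    (hw : ∀ i, ‖w i‖ ≤ 2) (k : ℕ) : ‖∑ i ∈ Finset.range k, w i‖ ≤ 2 * N := by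
  induction k using Nat.strong_induction_on with
  | _ k ih =>
    rcases lt_or_ge k N with h | h
    · refine (norm_sum_le _ _).trans ?_
      calc _ ≤ ∑ i ∈ Finset.range k, (2 : ℝ) := Finset.sum_le_sum fun i _ => hw i
        _ = 2 * k := by simp [mul_comm]
        _ ≤ _ := by gcongr
    · obtain ⟨j, rfl⟩ := Nat.exists_eq_add_of_le h
      rw [Finset.sum_range_add, hsum, zero_add, Finset.sum_congr rfl fun i _ => hper i]
      exact ih j (by omega)

/-- Means of a polynomial phase. -/
noncomputable def expMean (P : ℤ[X]) (t : ℕ) (x : ℝ) : ℂ :=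
  natAvg (fun m => expo ((P.eval (m : ℤ) : ℤ) * x)) t

/-- The normalised complete exponential sum at the rational point `A / N`. -/
noncomputable def gaussMean (P : ℤ[X]) (A : ℤ) (N : ℕ) : ℂ := expMean P N (A / N)

theorem expo_eval_div_eq_stdAddChar (P : ℤ[X]) (A : ℤ) (N : ℕ) [NeZero N] (m : ℕ) :
    expo ((P.eval (m : ℤ) : ℤ) * ((A : ℝ) / N))
      = ZMod.stdAddChar (((Polynomial.C A * P).map (Int.castRingHom (ZMod N))).eval (m : ZMod N)) := by
  have h : ((Polynomial.C A * P).map (Int.castRingHom (ZMod N))).eval (m : ZMod N)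
      = ((A * P.eval (m : ℤ) : ℤ) : ZMod N) := by
    simp
  rw [h, ZMod.stdAddChar_coe, expo]
  congr 1; push_cast; ring

theorem sum_range_natCast_zmod {N : ℕ} [NeZero N] (g : ZMod N → ℂ) :
    ∑ i ∈ Finset.range N, g ((i + 1 : ℕ) : ZMod N) = ∑ x : ZMod N, g x := by
  rw [← Equiv.sum_comp (Equiv.addRight (1 : ZMod N)) g]
  refine Finset.sum_nbij' (fun i => (i : ZMod N)) ZMod.val (by simp)
    (fun x _ => by simp [ZMod.val_lt x])
    (fun i hi => ZMod.val_cast_of_lt (by simpa using hi)) (by simp) (fun i _ => by simp)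

theorem gaussMean_eq (P : ℤ[X]) (A : ℤ) (N : ℕ) [NeZero N] :
    gaussMean P A N = (1 / (N : ℂ)) * ∑ x : ZMod N,
      ZMod.stdAddChar (((Polynomial.C A * P).map (Int.castRingHom (ZMod N))).eval x) := by
  rw [gaussMean, expMean, natAvg, ← sum_range_natCast_zmod]
  congr 1
  exact Finset.sum_congr rfl fun i _ => expo_eval_div_eq_stdAddChar P A N (i + 1)

theorem norm_expMean_le_one (P : ℤ[X]) {t : ℕ} (ht : 1 ≤ t) (x : ℝ) : ‖expMean P t x‖ ≤ 1 :=
  norm_natAvg_le ht fun _ _ _ => (norm_expo _).le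

/-- The sequence e(P(m)A/N) minus its mean is N-periodic with mean zero, so its partial sums are at
most 2N. Abel summation against e(P(m)η), whose variation is controlled by D|η|, gives the error. -/
theorem norm_expMean_add_sub_le (P : ℤ[X]) (A : ℤ) {N : ℕ} (hN : 1 ≤ N) (η : ℝ) {t : ℕ}
    (ht : 1 ≤ t) {D : ℝ}
    (hD : ∀ m : ℕ, 1 ≤ m → m ≤ t →
      |((P.eval ((m : ℤ) + 1) : ℤ) : ℝ) - (P.eval (m : ℤ) : ℤ)| ≤ D) :
    ‖expMean P t (A / N + η) - gaussMean P A N * expMean P t η‖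
      ≤ 2 * N * (1 + t * (2 * Real.pi * (D * |η|))) / t := by
  have : NeZero N := ⟨by omega⟩
  have hNc : (N : ℂ) ≠ 0 := by exact_mod_cast (by omega : N ≠ 0)
  have ht0 : (0 : ℝ) < t := by exact_mod_cast ht
  set w : ℕ → ℂ := fun i =>
    expo ((P.eval ((i + 1 : ℕ) : ℤ) : ℤ) * ((A : ℝ) / N)) - gaussMean P A N with hw
  set u : ℕ → ℂ := fun i => expo ((P.eval ((i + 1 : ℕ) : ℤ) : ℤ) * η) with hu
  have hper : ∀ i, w (N + i) = w i := by
    intro i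
    simp only [hw, expo_eval_div_eq_stdAddChar]
    congr 3; push_cast; simp
  have hsum : ∑ i ∈ Finset.range N, w i = 0 := by
    simp only [hw, Finset.sum_sub_distrib, Finset.sum_const, Finset.card_range, nsmul_eq_mul]
    rw [gaussMean, expMean, natAvg, ← mul_assoc, mul_one_div_cancel hNc, one_mul, sub_self]
  have hw2 : ∀ i, ‖w i‖ ≤ 2 := by
    intro i
    refine (norm_sub_le _ _).trans ?_
    have := norm_expMean_le_one P hN ((A : ℝ) / N)
    rw [norm_expo]
    simp only [gaussMean]
    linarith
  have habel := norm_sum_mul_le_of_partial_sums (u := u) (t := t)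
    fun k _ => norm_sum_range_le_of_periodic hN hper hsum hw2 k
  have hid : expMean P t (A / N + η) - gaussMean P A N * expMean P t η
      = (1 / (t : ℂ)) * ∑ i ∈ Finset.range t, w i * u i := by
    simp only [expMean, natAvg, hw, hu]
    rw [mul_left_comm, ← mul_sub]
    congr 1
    rw [Finset.mul_sum, ← Finset.sum_sub_distrib]
    refine Finset.sum_congr rfl fun i _ => ?_
    rw [mul_add, expo_add]
    ring
  rw [hid, norm_mul, norm_div, norm_one, Complex.norm_natCast, one_div, inv_mul_eq_div]
  gcongr
  refine habel.trans ?_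
  gcongr
  · exact (norm_expo _).le
  · calc _ ≤ ∑ i ∈ Finset.range t, 2 * Real.pi * (D * |η|) := by
          refine Finset.sum_le_sum fun i hi => (norm_expo_sub_le _ _).trans ?_
          have := hD (i + 1) (by omega) (by simpa using hi)
          rw [← sub_mul, abs_mul]
          push_cast at this ⊢
          gcongr
      _ = _ := by simp

/-! ### Decay of the means at small frequencies -/

/-- A Kuzmin–Landau type estimate. Each e(θ_i) is the difference e(θ_{i+1}) - e(θ_i) divided by
e(θ_{i+1} - θ_i) - 1. The differences telescope, and Abel summation handles the divisor, which stays
away from zero and varies slowly. -/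
theorem norm_sum_expo_le_of_increments {θ : ℕ → ℝ} {t : ℕ} {l μ : ℝ} (hl : 0 < l)
    (h1 : ∀ i ≤ t, l ≤ |θ (i + 1) - θ i|) (h2 : ∀ i ≤ t, |θ (i + 1) - θ i| ≤ 1 / 2)
    (h3 : ∀ i < t, |(θ (i + 2) - θ (i + 1)) - (θ (i + 1) - θ i)| ≤ μ) :
    ‖∑ i ∈ Finset.range t, expo (θ i)‖
      ≤ 2 * (1 / (4 * l) + t * (2 * Real.pi * μ / (4 * l) ^ 2)) := by
  set w : ℕ → ℂ := fun i => expo (θ (i + 1)) - expo (θ i) with hw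
  set u : ℕ → ℂ := fun i => (expo (θ (i + 1) - θ i) - 1)⁻¹ with hu
  have hlow : ∀ i ≤ t, 4 * l ≤ ‖expo (θ (i + 1) - θ i) - 1‖ := fun i hi =>
    le_trans (by have := h1 i hi; linarith) (le_norm_expo_sub_one (h2 i hi))
  have hne : ∀ i ≤ t, expo (θ (i + 1) - θ i) - 1 ≠ 0 := fun i hi =>
    norm_pos_iff.1 (lt_of_lt_of_le (by positivity) (hlow i hi))
  have hid : ∀ i ∈ Finset.range t, expo (θ i) = w i * u i := by
    intro i hi
    have hi' : i ≤ t := (Finset.mem_range.1 hi).le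
    rw [hu, hw, ← div_eq_mul_inv, eq_div_iff (hne i hi'), mul_sub, ← expo_add]
    simp
  rw [Finset.sum_congr rfl hid]
  refine (norm_sum_mul_le_of_partial_sums (W := 2) fun k _ => ?_).trans ?_
  · simp only [hw]
    rw [Finset.sum_range_sub fun i => expo (θ i)]
    refine (norm_sub_le _ _).trans ?_
    rw [norm_expo, norm_expo]; norm_num
  · gcongr
    · simp only [hu]
      rw [norm_inv, one_div]
      exact inv_anti₀ (by positivity) (hlow t le_rfl)
    · calc _ ≤ ∑ i ∈ Finset.range t, 2 * Real.pi * μ / (4 * l) ^ 2 := by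
            refine Finset.sum_le_sum fun i hi => ?_
            have hi' : i < t := Finset.mem_range.1 hi
            simp only [hu]
            rw [inv_sub_inv (hne _ hi') (hne _ hi'.le), norm_div, norm_mul]
            have hn : ‖(expo (θ (i + 1) - θ i) - 1) - (expo (θ (i + 1 + 1) - θ (i + 1)) - 1)‖
                ≤ 2 * Real.pi * μ := by
              rw [sub_sub_sub_cancel_right]
              refine (norm_expo_sub_le _ _).trans ?_
              have := h3 i hi'
              rw [abs_sub_comm] at this
              gcongr
            have ha := hlow _ hi'
            have hb := hlow _ hi'.le
            rw [sq]
            have hμ : 0 ≤ 2 * Real.pi * μ := (norm_nonneg _).trans hn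
            exact div_le_div₀ hμ hn (by positivity)
              (mul_le_mul ha hb (by positivity) (norm_nonneg _))
        _ = _ := by simp

theorem exists_abs_eval_le (Q : ℤ[X]) {k : ℕ} (hQ : Q.natDegree ≤ k) :
    ∃ C : ℝ, 1 ≤ C ∧ ∀ m : ℕ, 1 ≤ m → |((Q.eval (m : ℤ) : ℤ) : ℝ)| ≤ C * (m : ℝ) ^ k := by
  refine ⟨1 + ∑ i ∈ Finset.range (k + 1), |(Q.coeff i : ℝ)|,
    le_add_of_nonneg_right (by positivity), fun m hm => ?_⟩
  have hm1 : (1 : ℝ) ≤ m := by exact_mod_cast hm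
  rw [Polynomial.eval_eq_sum_range' (Nat.lt_succ_of_le hQ)]
  push_cast
  refine (Finset.abs_sum_le_sum_abs _ _).trans ?_
  rw [add_mul, Finset.sum_mul]
  refine le_add_of_nonneg_of_le (by positivity) (Finset.sum_le_sum fun i hi => ?_)
  rw [abs_mul, abs_of_nonneg (by positivity : (0 : ℝ) ≤ (m : ℝ) ^ i)]
  gcongr
  exact Nat.lt_succ_iff.1 (Finset.mem_range.1 hi)

theorem exists_le_eval (Q : ℤ[X]) {k : ℕ} (hQ : Q.natDegree ≤ k) (hc : 1 ≤ Q.coeff k) :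
    ∃ M : ℕ, ∀ m : ℕ, M ≤ m → (m : ℝ) ^ k / 2 ≤ ((Q.eval (m : ℤ) : ℤ) : ℝ) := by
  rcases Nat.eq_zero_or_pos k with rfl | hk
  · refine ⟨0, fun m _ => ?_⟩
    rw [Polynomial.eq_C_of_natDegree_le_zero hQ]
    have : (1 : ℝ) ≤ Q.coeff 0 := by exact_mod_cast hc
    simp
    linarith
  obtain ⟨j, rfl⟩ : ∃ j, k = j + 1 := ⟨k - 1, by omega⟩
  obtain ⟨C, hC, hb⟩ := exists_abs_eval_le (Q - Polynomial.C (Q.coeff (j + 1)) * Polynomial.X ^ (j + 1))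
    (k := j) (by
      rw [Polynomial.natDegree_le_iff_coeff_eq_zero]
      intro i hi
      rw [Polynomial.coeff_sub, Polynomial.coeff_C_mul, Polynomial.coeff_X_pow]
      rcases eq_or_ne i (j + 1) with rfl | h
      · simp
      · rw [Polynomial.coeff_eq_zero_of_natDegree_lt (by omega)]
        simp [h])
  refine ⟨⌈2 * C⌉₊ + 1, fun m hm => ?_⟩
  have hm1 : 2 * C ≤ m := (Nat.le_ceil _).trans (by exact_mod_cast (by omega))
  have h1 := (abs_le.1 (hb m (by omega))).1
  simp only [Polynomial.eval_sub, Polynomial.eval_mul, Polynomial.eval_C, Polynomial.eval_pow,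
    Polynomial.eval_X] at h1
  push_cast at h1
  have hc' : (1 : ℝ) ≤ Q.coeff (j + 1) := by exact_mod_cast hc
  have h2 : (m : ℝ) ^ (j + 1) ≤ Q.coeff (j + 1) * (m : ℝ) ^ (j + 1) :=
    le_mul_of_one_le_left (by positivity) hc'
  have h3 : 2 * C * (m : ℝ) ^ j ≤ (m : ℝ) ^ (j + 1) := by
    rw [pow_succ']; gcongr
  linarith

theorem eval_taylor_one_sub (P : ℤ[X]) (m : ℤ) :
    (Polynomial.taylor 1 P - P).eval m = P.eval (m + 1) - P.eval m := by
  rw [Polynomial.eval_sub, Polynomial.taylor_eval]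

/-- The input for the Kuzmin–Landau estimate. The bound on second differences is multiplied by m so
that it reads uniformly in e: for e = 0 they vanish. -/
theorem exists_poly_increment_bounds (P : ℤ[X]) {e : ℕ} (hd : P.natDegree = e + 1)
    (hP : 0 < P.leadingCoeff) :
    ∃ (C : ℝ) (M : ℕ), 1 ≤ C ∧
      (∀ m : ℕ, 1 ≤ m → |((P.eval (m : ℤ) : ℤ) : ℝ) - (P.eval 0 : ℤ)| ≤ C * (m : ℝ) ^ (e + 1)) ∧
      (∀ m : ℕ, 1 ≤ m →
        |((P.eval ((m : ℤ) + 1) : ℤ) : ℝ) - (P.eval (m : ℤ) : ℤ)| ≤ C * (m : ℝ) ^ e) ∧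
      (∀ m : ℕ, 1 ≤ m → m * |(((P.eval ((m : ℤ) + 2) : ℤ) : ℝ) - (P.eval ((m : ℤ) + 1) : ℤ)) -
        ((P.eval ((m : ℤ) + 1) : ℤ) - (P.eval (m : ℤ) : ℤ))| ≤ C * (m : ℝ) ^ e) ∧
      (∀ m : ℕ, M ≤ m →
        (m : ℝ) ^ e / 2 ≤ ((P.eval ((m : ℤ) + 1) : ℤ) : ℝ) - (P.eval (m : ℤ) : ℤ)) := by
  obtain ⟨hQ, hQc⟩ := coeff_taylor_sub_self P e hd.le 1
  set Q := Polynomial.taylor 1 P - P with hQdef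
  have hQe : ∀ m : ℤ, ((Q.eval m : ℤ) : ℝ) = ((P.eval (m + 1) : ℤ) : ℝ) - (P.eval m : ℤ) :=
    fun m => by rw [hQdef, eval_taylor_one_sub]; push_cast; ring
  obtain ⟨C1, hC1, h1⟩ := exists_abs_eval_le (P - Polynomial.C (P.eval 0)) (k := e + 1)
    (by rw [Polynomial.natDegree_sub_C]; exact hd.le)
  obtain ⟨C2, hC2, h2⟩ := exists_abs_eval_le Q hQ
  obtain ⟨C3, hC3, h3⟩ : ∃ C : ℝ, 1 ≤ C ∧ ∀ m : ℕ, 1 ≤ m →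
      m * |((Q.eval ((m : ℤ) + 1) : ℤ) : ℝ) - (Q.eval (m : ℤ) : ℤ)| ≤ C * (m : ℝ) ^ e := by
    rcases Nat.eq_zero_or_pos e with rfl | he
    · refine ⟨1, le_rfl, fun m _ => ?_⟩
      rw [Polynomial.eq_C_of_natDegree_le_zero hQ]
      simp
    · obtain ⟨j, rfl⟩ : ∃ j, e = j + 1 := ⟨e - 1, by omega⟩
      obtain ⟨hR, -⟩ := coeff_taylor_sub_self Q j hQ 1
      obtain ⟨C, hC, hb⟩ := exists_abs_eval_le _ hR
      refine ⟨C, hC, fun m hm => ?_⟩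
      have := hb m hm
      rw [eval_taylor_one_sub] at this
      push_cast at this
      calc _ ≤ m * (C * (m : ℝ) ^ j) := by gcongr
        _ = _ := by ring
  obtain ⟨M, hM⟩ := exists_le_eval Q hQ (by
    have hlc : P.coeff (e + 1) = P.leadingCoeff := by rw [← hd, Polynomial.coeff_natDegree]
    have : 0 < (e + 1) • P.leadingCoeff := by positivity
    rw [hQc, one_mul, hlc]
    exact this)
  refine ⟨C1 + C2 + C3, M, by linarith, fun m hm => ?_, fun m hm => ?_, fun m hm => ?_,
    fun m hm => ?_⟩
  · have := h1 m hm
    simp only [Polynomial.eval_sub, Polynomial.eval_C] at this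
    push_cast at this
    refine this.trans ?_
    gcongr; linarith
  · rw [← hQe]
    refine (h2 m hm).trans ?_
    gcongr; linarith
  · have := h3 m hm
    rw [hQe, hQe] at this
    have e2 : (m : ℤ) + 1 + 1 = m + 2 := by ring
    rw [e2] at this
    refine this.trans ?_
    gcongr; linarith
  · rw [← hQe]; exact hM m hm

/-- Decay of polynomial exponential means at small frequencies. -/
theorem exists_norm_expMean_le_rpow (P : ℤ[X]) {e : ℕ} (hd : P.natDegree = e + 1)
    (hP : 0 < P.leadingCoeff) :
    ∃ (K : ℝ) (n₀ : ℕ), 1 ≤ K ∧ ∀ n ≥ n₀, ∀ η X : ℝ, X = |η| * ((2 : ℝ) ^ n) ^ (e + 1) →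
      1 ≤ X → X ≤ ((2 : ℝ) ^ n) ^ (1 / 10 : ℝ) → ∀ t ∈ Set.Icc (2 ^ n) (2 ^ (n + 1)),
        ‖expMean P t η‖ ≤ K * X ^ (-(1 / (2 * (e + 1))) : ℝ) := by
  obtain ⟨C, M, hC, -, h1, h2, h3⟩ := exists_poly_increment_bounds P hd hP
  have hlim : Filter.Tendsto (fun n : ℕ => ((2 : ℝ) ^ n) ^ (9 / 10 : ℝ)) Filter.atTop
      Filter.atTop :=
    (tendsto_rpow_atTop (by norm_num)).comp (tendsto_pow_atTop_atTop_of_one_lt one_lt_two)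
  obtain ⟨n₀, hn₀⟩ := Filter.eventually_atTop.1
    (hlim.eventually_ge_atTop ((M : ℝ) + 2 * C * 4 ^ e + 1))
  -- The constant adds 2 for the initial segment, 1 for the boundary term and π C 4^e for the
  -- variation term of the Kuzmin–Landau estimate.
  refine ⟨3 + Real.pi * C * 4 ^ e, n₀, ?_, fun n hn η X hX hX1 hXZ t ht => ?_⟩
  · have : 0 ≤ Real.pi * C * 4 ^ e := by positivity
    linarith
  have hR := hn₀ n hn
  have hCe : 0 ≤ 2 * C * 4 ^ e := by positivity
  have hM0 : (0 : ℝ) ≤ M := Nat.cast_nonneg M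
  set Z : ℝ := (2 : ℝ) ^ n with hZ
  have hZ1 : 1 ≤ Z := one_le_pow₀ one_le_two
  have hZ0 : 0 < Z := by linarith
  set R : ℝ := Z ^ (9 / 10 : ℝ) with hRdef
  have hRZ : Z ^ (1 / 10 : ℝ) * R = Z := by
    rw [hRdef, ← Real.rpow_add hZ0]; norm_num
  have hR0 : 0 < R := by positivity
  have hX0 : 0 < X := by linarith
  have hη : 0 < |η| := by
    by_contra h
    have : |η| = 0 := le_antisymm (not_lt.1 h) (abs_nonneg _)
    rw [this, zero_mul] at hX; linarith
  have htZ : Z ≤ t := by rw [hZ]; exact_mod_cast ht.1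
  have htZ2 : (t : ℝ) ≤ 2 * Z := by
    have := ht.2
    rw [pow_succ'] at this
    rw [hZ]; exact_mod_cast this
  have ht0 : (0 : ℝ) < t := by linarith
  -- Chosen so that X ε^{2e+2} = 1: discarding the first ε t terms then costs as much as the main
  -- error 1 / (X ε^{2e+1}).
  set ε : ℝ := X ^ (-(1 / (2 * (e + 1))) : ℝ) with hε
  have hε0 : 0 < ε := by positivity
  have hε1 : ε ≤ 1 := Real.rpow_le_one_of_one_le_of_nonpos hX1 (by
    rw [neg_nonpos]; positivity)
  have hεX : X * ε ^ (2 * e + 2) = 1 := by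
    rw [hε, ← Real.rpow_natCast, ← Real.rpow_mul hX0.le]
    have : (-(1 / (2 * ((e : ℝ) + 1)))) * ((2 * e + 2 : ℕ) : ℝ) = -1 := by
      push_cast; field_simp
    rw [this, Real.rpow_neg_one, mul_inv_cancel₀ hX0.ne']
  have hεR : R ≤ ε * Z := by
    have hXε : X ^ (-1 : ℝ) ≤ ε := Real.rpow_le_rpow_of_exponent_le hX1 (by
      rw [neg_le_neg_iff, div_le_one (by positivity)]
      have : (0 : ℝ) ≤ e := Nat.cast_nonneg e
      linarith)
    have : 1 ≤ ε * Z ^ (1 / 10 : ℝ) := by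
      rw [Real.rpow_neg_one] at hXε
      calc (1 : ℝ) = X⁻¹ * X := (inv_mul_cancel₀ hX0.ne').symm
        _ ≤ _ := by gcongr
    calc R = 1 * R := (one_mul R).symm
      _ ≤ ε * Z ^ (1 / 10 : ℝ) * R := by gcongr
      _ = _ := by rw [mul_assoc, hRZ]
  -- The hypothesis X ≤ Z^{1/10} makes the phase increments as small as 1/R; since R exceeds 2 C 4^e
  -- they are at most 1/2, with no wrapping modulo 1.
  have hηR : |η| * Z ^ e * R ≤ 1 := by
    have : (|η| * Z ^ e * R) * Z ≤ 1 * Z := by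
      calc _ = X * R := by rw [hX]; ring
        _ ≤ Z ^ (1 / 10 : ℝ) * R := by gcongr
        _ = _ := by rw [hRZ, one_mul]
    exact le_of_mul_le_mul_right this hZ0
  -- The first L terms are bounded trivially; beyond them the phase increments are at least |η| L^e
  -- / 2.
  set L : ℕ := ⌈ε * t⌉₊ with hL
  have hLge : ε * t ≤ L := Nat.le_ceil _
  have hLZ : ε * Z ≤ L := le_trans (by gcongr) hLge
  have hLle : (L : ℝ) ≤ ε * t + 1 := (Nat.ceil_lt_add_one (by positivity)).le
  have hLt : L ≤ t := Nat.ceil_le.2 (mul_le_of_le_one_left ht0.le hε1)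
  have hML : M ≤ L := by
    have : (M : ℝ) ≤ L := by linarith
    exact_mod_cast this
  have hL0 : (0 : ℝ) < L := lt_of_lt_of_le (by positivity) hLZ
  set k : ℕ := t - L with hk
  have hkt : (k : ℝ) ≤ t := by exact_mod_cast Nat.sub_le t L
  set θ : ℕ → ℝ := fun i => (P.eval ((L + i + 1 : ℕ) : ℤ) : ℤ) * η with hθ
  have hdiff : ∀ i, θ (i + 1) - θ i = ((P.eval (((L + i + 1 : ℕ) : ℤ) + 1) : ℤ) -
      (P.eval ((L + i + 1 : ℕ) : ℤ) : ℤ)) * η := fun i => by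
    simp only [hθ]; rw [sub_mul]; congr 5
  have hm4 : ∀ i ≤ k, ((L + i + 1 : ℕ) : ℝ) ≤ 4 * Z := fun i hi => by
    have : ((L + i + 1 : ℕ) : ℝ) ≤ t + 1 := by
      exact_mod_cast (by omega : L + i + 1 ≤ t + 1)
    linarith
  have hmL : ∀ i, (L : ℝ) ≤ ((L + i + 1 : ℕ) : ℝ) := fun i => by
    exact_mod_cast (by omega : L ≤ L + i + 1)
  have hmain := norm_sum_expo_le_of_increments (θ := θ) (t := k) (l := |η| * (L : ℝ) ^ e / 2)
    (μ := |η| * (C * (4 * Z) ^ e / L)) (by positivity)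
    (fun i hi => by
      rw [hdiff, abs_mul]
      have := h3 (L + i + 1) (by omega)
      have h4 : (L : ℝ) ^ e / 2 ≤ ((L + i + 1 : ℕ) : ℝ) ^ e / 2 := by gcongr; omega
      calc _ = (L : ℝ) ^ e / 2 * |η| := by ring
        _ ≤ _ := by gcongr; exact (h4.trans this).trans (le_abs_self _))
    (fun i hi => by
      rw [hdiff, abs_mul]
      have h4 : (2 * C * 4 ^ e) * (|η| * Z ^ e) ≤ 1 := by
        refine le_trans ?_ hηR
        rw [mul_comm (|η| * Z ^ e)]
        gcongr; linarith
      calc _ ≤ C * (4 * Z) ^ e * |η| := by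
            gcongr
            refine (h1 (L + i + 1) (by omega)).trans ?_
            gcongr; exact hm4 i hi
        _ = (2 * C * 4 ^ e) * (|η| * Z ^ e) / 2 := by rw [mul_pow]; ring
        _ ≤ _ := by linarith)
    (fun i hi => by
      rw [hdiff, hdiff, ← sub_mul, abs_mul, mul_comm]
      gcongr
      have hb := h2 (L + i + 1) (by omega)
      have hmpos : (0 : ℝ) < ((L + i + 1 : ℕ) : ℝ) := by exact_mod_cast (by omega)
      have e1 : ((L + (i + 1) + 1 : ℕ) : ℤ) = ((L + i + 1 : ℕ) : ℤ) + 1 := by push_cast; ring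
      have e2 : ((L + i + 1 : ℕ) : ℤ) + 1 + 1 = ((L + i + 1 : ℕ) : ℤ) + 2 := by ring
      rw [e1, e2]
      rw [← le_div_iff₀' hmpos] at hb
      refine hb.trans ?_
      gcongr
      · exact hm4 i hi.le
      · omega)
  have hsplit : ‖expMean P t η‖ ≤ (L + 2 * (1 / (4 * (|η| * (L : ℝ) ^ e / 2)) +
      k * (2 * Real.pi * (|η| * (C * (4 * Z) ^ e / L)) /
        (4 * (|η| * (L : ℝ) ^ e / 2)) ^ 2))) / t := by
    rw [expMean, natAvg, norm_mul, norm_div, norm_one, Complex.norm_natCast, one_div,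
      inv_mul_eq_div]
    gcongr
    have : t = L + k := by omega
    rw [this, Finset.sum_range_add]
    refine (norm_add_le _ _).trans (add_le_add ?_ hmain)
    refine (norm_sum_le _ _).trans ?_
    simp [norm_expo]
  refine hsplit.trans ?_
  rw [div_le_iff₀ ht0]
  have hinv : ∀ j : ℕ, j ≤ 2 * e + 1 → 1 / (X * ε ^ j) ≤ ε := by
    intro j hj
    rw [div_le_iff₀ (by positivity)]
    calc (1 : ℝ) = X * ε ^ (2 * e + 2) := hεX.symm
      _ ≤ X * ε ^ (j + 1) := by
        gcongr ?_ * ?_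
        exact pow_le_pow_of_le_one hε0.le hε1 (by omega)
      _ = _ := by ring
  have hone : (1 : ℝ) ≤ ε * t := by
    have : R ≤ ε * t := hεR.trans (by gcongr)
    linarith
  have T1 : 2 * (1 / (4 * (|η| * (L : ℝ) ^ e / 2))) ≤ ε * t := by
    calc _ = 1 / (|η| * (L : ℝ) ^ e) := by field_simp; norm_num
      _ ≤ 1 / (|η| * (ε * Z) ^ e) := by gcongr
      _ = 1 / (X * ε ^ e) * Z := by rw [hX, mul_pow]; field_simp; ring
      _ ≤ ε * t := by gcongr; exact hinv e (by omega)
  have T2 : 2 * (k * (2 * Real.pi * (|η| * (C * (4 * Z) ^ e / L)) /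
        (4 * (|η| * (L : ℝ) ^ e / 2)) ^ 2)) ≤ Real.pi * C * 4 ^ e * ε * t := by
    calc _ = k * (Real.pi * C * (4 * Z) ^ e / (|η| * (L : ℝ) ^ (2 * e + 1))) := by
          field_simp; ring
      _ ≤ t * (Real.pi * C * (4 * Z) ^ e / (|η| * (ε * Z) ^ (2 * e + 1))) := by gcongr
      _ = t * (Real.pi * C * 4 ^ e * (1 / (X * ε ^ (2 * e + 1)))) := by
          rw [hX, mul_pow, mul_pow]; field_simp; ring
      _ ≤ t * (Real.pi * C * 4 ^ e * ε) := by gcongr; exact hinv _ le_rfl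
      _ = _ := by ring
  rw [mul_add]
  linarith

/-! ### Dyadic energy of the multipliers at small frequencies -/

/-- Subtracting the constant e(c) does not affect differences of means and leaves summands of size
at most 2π B. -/
theorem norm_expMean_sub_le_of_dist {P : ℤ[X]} {n : ℕ} {x c B : ℝ} (hB : 0 ≤ B)
    (h : ∀ m : ℕ, 1 ≤ m → m ≤ 2 ^ (n + 1) → |(P.eval (m : ℤ) : ℤ) * x - c| ≤ B)
    {t t' : ℕ} (ht : t ∈ Set.Icc (2 ^ n) (2 ^ (n + 1)))
    (ht' : t' ∈ Set.Icc (2 ^ n) (2 ^ (n + 1))) :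
    ‖expMean P t x - expMean P t' x‖ ≤ 4 * Real.pi * B * (|(t : ℝ) - t'| / 2 ^ n) := by
  wlog htt : t ≤ t' generalizing t t'
  · rw [norm_sub_rev, abs_sub_comm]
    exact this ht' ht (by omega)
  have h2n : 1 ≤ 2 ^ n := Nat.one_le_two_pow
  have ht1 : 1 ≤ t := h2n.trans ht.1
  have hid : expMean P t x - expMean P t' x =
      natAvg (fun m => expo ((P.eval (m : ℤ) : ℤ) * x) - expo c) t -
      natAvg (fun m => expo ((P.eval (m : ℤ) : ℤ) * x) - expo c) t' := by
    rw [natAvg_sub, natAvg_sub, natAvg_const _ ht1, natAvg_const _ (ht1.trans htt)]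
    simp [expMean]
  rw [hid]
  refine (norm_natAvg_sub_natAvg_le (B := 2 * Real.pi * B) ht1 htt fun m h1 h2 => ?_).trans ?_
  · refine (norm_expo_sub_le _ _).trans ?_
    gcongr
    exact h m h1 (h2.trans ht'.2)
  · have h1 : (t : ℝ) ≤ t' := by exact_mod_cast htt
    have h3 : (2 : ℝ) ^ n ≤ t' := by exact_mod_cast ht'.1
    rw [abs_sub_comm, abs_of_nonneg (by linarith)]
    have h4 : ((t' : ℝ) - t) / t' ≤ ((t' : ℝ) - t) / 2 ^ n := by
      gcongr
    calc _ ≤ 2 * (2 * Real.pi * B) * (((t' : ℝ) - t) / 2 ^ n) := by gcongr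
      _ = _ := by ring

theorem norm_expMean_sub_le {P : ℤ[X]} {n : ℕ} (x : ℝ) {t t' : ℕ}
    (ht : t ∈ Set.Icc (2 ^ n) (2 ^ (n + 1))) (ht' : t' ∈ Set.Icc (2 ^ n) (2 ^ (n + 1))) :
    ‖expMean P t x - expMean P t' x‖ ≤ 2 * (|(t : ℝ) - t'| / 2 ^ n) := by
  wlog htt : t ≤ t' generalizing t t'
  · rw [norm_sub_rev, abs_sub_comm]
    exact this ht' ht (by omega)
  have h2n : 1 ≤ 2 ^ n := Nat.one_le_two_pow
  have ht1 : 1 ≤ t := h2n.trans ht.1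
  refine (norm_natAvg_sub_natAvg_le (B := 1) ht1 htt fun m h1 h2 => (norm_expo _).le).trans ?_
  have h1 : (t : ℝ) ≤ t' := by exact_mod_cast htt
  have h3 : (2 : ℝ) ^ n ≤ t' := by exact_mod_cast ht'.1
  rw [abs_sub_comm, abs_of_nonneg (by linarith), mul_one]
  gcongr

/-- Interpolates between the Lipschitz and the uniform bound. Level l has 2^l + 1 increments, each
at most K min(Y, y) with y = 2^{-l}, and min(Y, y)² ≤ √Y √y y. Half a power of y beats the weight
because 6/5 < √2, and √Y keeps part of the gain. -/
theorem dyadicEnergy_le {n : ℕ} {a : ℕ → ℂ} {K Y : ℝ} (hK : 0 ≤ K) (hY : 0 ≤ Y)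
    (h1 : ∀ t ∈ Set.Icc (2 ^ n) (2 ^ (n + 1)), ∀ t' ∈ Set.Icc (2 ^ n) (2 ^ (n + 1)),
      ‖a t - a t'‖ ≤ K * (|(t : ℝ) - t'| / 2 ^ n))
    (h2 : ∀ t ∈ Set.Icc (2 ^ n) (2 ^ (n + 1)), ∀ t' ∈ Set.Icc (2 ^ n) (2 ^ (n + 1)),
      ‖a t - a t'‖ ≤ K * Y) : dyadicEnergy n a ≤ 14 * K ^ 2 * √Y := by
  have hterm : ∀ l ∈ Finset.range (n + 1), (6 / 5 : ℝ) ^ l * ∑ j ∈ Finset.range (2 ^ l + 1),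
      ‖a (2 ^ n + 2 ^ (n - l) * j) - a (2 ^ n + 2 ^ (n - l) * (2 * (j / 2)))‖ ^ 2
      ≤ 2 * K ^ 2 * √Y * (6 / 7 : ℝ) ^ l := by
    intro l hl
    have hl' : l ≤ n := Nat.lt_succ_iff.1 (Finset.mem_range.1 hl)
    set y : ℝ := (1 / 2 : ℝ) ^ l with hy
    have hy0 : 0 < y := by positivity
    -- 1/√2 < 5/7, and (6/5)(5/7) = 6/7 is the ratio of the final series, whose sum is 7.
    have hsy : √y ≤ (5 / 7 : ℝ) ^ l := by
      refine Real.sqrt_le_iff.2 ⟨by positivity, ?_⟩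
      rw [← pow_mul, mul_comm, pow_mul]
      exact pow_le_pow_left₀ (by norm_num) (by norm_num) l
    have hpn : 2 ^ (n - l) * 2 ^ l = 2 ^ n := by rw [← pow_add]; congr 1; omega
    have hmem : ∀ j ≤ 2 ^ l, 2 ^ n + 2 ^ (n - l) * j ∈ Set.Icc (2 ^ n) (2 ^ (n + 1)) := by
      intro j hj
      refine ⟨Nat.le_add_right _ _, ?_⟩
      have := Nat.mul_le_mul_left (2 ^ (n - l)) hj
      rw [hpn] at this
      rw [pow_succ]; omega
    have hj : ∀ j ∈ Finset.range (2 ^ l + 1),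
        ‖a (2 ^ n + 2 ^ (n - l) * j) - a (2 ^ n + 2 ^ (n - l) * (2 * (j / 2)))‖ ^ 2
          ≤ K ^ 2 * (√Y * √y * y) := by
      intro j hj
      have hj' : j ≤ 2 ^ l := Nat.lt_succ_iff.1 (Finset.mem_range.1 hj)
      have ha := hmem j hj'
      have hb := hmem (2 * (j / 2)) (by omega)
      have b2 := h2 _ ha _ hb
      have b1 : ‖a (2 ^ n + 2 ^ (n - l) * j) - a (2 ^ n + 2 ^ (n - l) * (2 * (j / 2)))‖
          ≤ K * y := by
        refine (h1 _ ha _ hb).trans ?_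
        gcongr
        have e1 : (((2 ^ n + 2 ^ (n - l) * j : ℕ) : ℝ)
            - ((2 ^ n + 2 ^ (n - l) * (2 * (j / 2)) : ℕ) : ℝ))
            = 2 ^ (n - l) * ((j : ℝ) - ((2 * (j / 2) : ℕ) : ℝ)) := by push_cast; ring
        have e2 : |(j : ℝ) - ((2 * (j / 2) : ℕ) : ℝ)| ≤ 1 := by
          have u1 : ((2 * (j / 2) : ℕ) : ℝ) ≤ j := by exact_mod_cast (by omega)
          have u2 : (j : ℝ) ≤ ((2 * (j / 2) : ℕ) : ℝ) + 1 := by exact_mod_cast (by omega)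
          rw [abs_le]; constructor <;> linarith
        rw [e1, abs_mul, abs_of_pos (by positivity : (0 : ℝ) < 2 ^ (n - l)),
          div_le_iff₀ (by positivity)]
        have e3 : y * 2 ^ n = 2 ^ (n - l) := by
          have : (2 : ℝ) ^ n = 2 ^ (n - l) * 2 ^ l := by exact_mod_cast hpn.symm
          rw [this, hy, one_div, inv_pow]; field_simp
        rw [e3]
        exact mul_le_of_le_one_right (by positivity) e2
      have hmin : ‖a (2 ^ n + 2 ^ (n - l) * j) - a (2 ^ n + 2 ^ (n - l) * (2 * (j / 2)))‖
          ≤ K * min Y y := by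
        rw [mul_min_of_nonneg _ _ hK]; exact le_min b2 b1
      have hg0 : 0 ≤ min Y y := le_min hY hy0.le
      calc _ ≤ (K * min Y y) ^ 2 := by gcongr
        _ = K ^ 2 * (√(min Y y) * √(min Y y) * min Y y) := by
          rw [Real.mul_self_sqrt hg0]; ring
        _ ≤ K ^ 2 * (√Y * √y * y) := by
          gcongr
          · exact min_le_left _ _
          · exact min_le_right _ _
          · exact min_le_right _ _
    calc _ ≤ (6 / 5 : ℝ) ^ l * ∑ j ∈ Finset.range (2 ^ l + 1), K ^ 2 * (√Y * √y * y) := by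
          gcongr with j hjm; exact hj j hjm
      _ = (6 / 5 : ℝ) ^ l * ((2 ^ l + 1) * (K ^ 2 * (√Y * √y * y))) := by simp
      _ ≤ (6 / 5 : ℝ) ^ l * ((2 * 2 ^ l) * (K ^ 2 * (√Y * (5 / 7 : ℝ) ^ l * y))) := by
          gcongr
          have : (1 : ℝ) ≤ 2 ^ l := one_le_pow₀ one_le_two
          linarith
      _ = 2 * K ^ 2 * √Y * (((6 / 5 : ℝ) * (5 / 7)) ^ l * (2 ^ l * y)) := by
          rw [mul_pow]; ring
      _ = _ := by
          have : (2 : ℝ) ^ l * y = 1 := by rw [hy, ← mul_pow]; norm_num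
          rw [this]; norm_num
  have hg : ∑ l ∈ Finset.range (n + 1), (6 / 7 : ℝ) ^ l ≤ 7 := by
    have := Summable.sum_le_tsum (Finset.range (n + 1)) (fun i _ => by positivity)
      (summable_geometric_of_lt_one (by norm_num : (0 : ℝ) ≤ 6 / 7) (by norm_num))
    rw [tsum_geometric_of_lt_one (by norm_num) (by norm_num)] at this
    norm_num at this ⊢
    exact this
  calc _ ≤ ∑ l ∈ Finset.range (n + 1), 2 * K ^ 2 * √Y * (6 / 7 : ℝ) ^ l :=
        Finset.sum_le_sum hterm
    _ = 2 * K ^ 2 * √Y * ∑ l ∈ Finset.range (n + 1), (6 / 7 : ℝ) ^ l := by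
        rw [Finset.mul_sum]
    _ ≤ 2 * K ^ 2 * √Y * 7 := by gcongr
    _ = _ := by ring

theorem dyadicEnergy_add_le (n : ℕ) (a b : ℕ → ℂ) :
    dyadicEnergy n (fun t => a t + b t) ≤ 2 * dyadicEnergy n a + 2 * dyadicEnergy n b := by
  simp only [dyadicEnergy, Finset.mul_sum, ← Finset.sum_add_distrib]
  refine Finset.sum_le_sum fun l _ => Finset.sum_le_sum fun j _ => ?_
  have hw : (0 : ℝ) ≤ (6 / 5 : ℝ) ^ l := by positivity
  have key : ∀ z w : ℂ, ‖z + w‖ ^ 2 ≤ 2 * ‖z‖ ^ 2 + 2 * ‖w‖ ^ 2 := fun z w => by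
    have := norm_add_le z w
    nlinarith [norm_nonneg (z + w), sq_nonneg (‖z‖ - ‖w‖)]
  have := key (a (2 ^ n + 2 ^ (n - l) * j) - a (2 ^ n + 2 ^ (n - l) * (2 * (j / 2))))
    (b (2 ^ n + 2 ^ (n - l) * j) - b (2 ^ n + 2 ^ (n - l) * (2 * (j / 2))))
  rw [add_sub_add_comm]
  nlinarith [mul_le_mul_of_nonneg_left this hw]

theorem dyadicEnergy_const_mul (n : ℕ) (c : ℂ) (a : ℕ → ℂ) :
    dyadicEnergy n (fun t => c * a t) = ‖c‖ ^ 2 * dyadicEnergy n a := by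
  simp only [dyadicEnergy, Finset.mul_sum, ← mul_sub, norm_mul, mul_pow]
  exact Finset.sum_congr rfl fun l _ => Finset.sum_congr rfl fun j _ => by ring

theorem abs_sub_div_two_pow_le_one {n t t' : ℕ} (ht : t ∈ Set.Icc (2 ^ n) (2 ^ (n + 1)))
    (ht' : t' ∈ Set.Icc (2 ^ n) (2 ^ (n + 1))) : |(t : ℝ) - t'| / 2 ^ n ≤ 1 := by
  have a1 : (2 : ℝ) ^ n ≤ t := by exact_mod_cast ht.1
  have a2 : (2 : ℝ) ^ n ≤ t' := by exact_mod_cast ht'.1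
  have b1 : (t : ℝ) ≤ 2 ^ (n + 1) := by exact_mod_cast ht.2
  have b2 : (t' : ℝ) ≤ 2 ^ (n + 1) := by exact_mod_cast ht'.2
  rw [pow_succ] at b1 b2
  rw [div_le_one (by positivity), abs_le]
  constructor <;> linarith

theorem dyadicEnergy_expMean_le (P : ℤ[X]) (n : ℕ) (x : ℝ) :
    dyadicEnergy n (fun t => expMean P t x) ≤ 56 := by
  refine (dyadicEnergy_le (K := 2) (Y := 1) (by norm_num) (by norm_num)
    (fun t ht t' ht' => norm_expMean_sub_le x ht ht') (fun t ht t' ht' => ?_)).trans ?_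
  · refine (norm_expMean_sub_le x ht ht').trans ?_
    gcongr
    exact abs_sub_div_two_pow_le_one ht ht'
  · norm_num

/-- The function equal to `X ^ p` on `[0, 1]` and to `X ^ (-p)` on `(1, ∞)`. -/
noncomputable def decayProfile (p X : ℝ) : ℝ := if X ≤ 1 then X ^ p else X ^ (-p)

theorem decayProfile_nonneg (p : ℝ) {X : ℝ} (hX : 0 ≤ X) : 0 ≤ decayProfile p X := by
  rw [decayProfile]; split_ifs <;> positivity

theorem exists_dyadicEnergy_expMean_le_decayProfile (P : ℤ[X]) {e : ℕ}
    (hd : P.natDegree = e + 1) (hP : 0 < P.leadingCoeff) :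
    ∃ (K p : ℝ) (n₀ : ℕ), 0 < K ∧ 0 < p ∧ ∀ n ≥ n₀, ∀ η X : ℝ,
      X = |η| * ((2 : ℝ) ^ n) ^ (e + 1) → X ≤ ((2 : ℝ) ^ n) ^ (1 / 10 : ℝ) →
        dyadicEnergy n (fun t => expMean P t η) ≤ K * decayProfile p X := by
  obtain ⟨C, M, hC, h1, -⟩ := exists_poly_increment_bounds P hd hP
  obtain ⟨K, n₀, hK, hdec⟩ := exists_norm_expMean_le_rpow P hd hP
  set B : ℝ := 4 * Real.pi * (C * 2 ^ (e + 1)) with hB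
  have hB0 : 0 < B := by positivity
  -- Half of the exponent in the decay of the means, because `dyadicEnergy_le` yields √Y.
  set p : ℝ := 1 / (4 * (e + 1)) with hp
  have hp0 : 0 < p := by positivity
  have hp2 : p ≤ 1 / 2 := by
    rw [hp]
    have : (0 : ℝ) ≤ e := Nat.cast_nonneg e
    exact one_div_le_one_div_of_le two_pos (by linarith)
  refine ⟨14 * B ^ 2 + 14 * (2 * K) ^ 2, p, n₀, by positivity, hp0, fun n hn η X hX hXZ => ?_⟩
  have hX0 : 0 ≤ X := by rw [hX]; positivity
  rw [decayProfile]
  split_ifs with hX1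
  · have hb1 : ∀ t ∈ Set.Icc (2 ^ n) (2 ^ (n + 1)), ∀ t' ∈ Set.Icc (2 ^ n) (2 ^ (n + 1)),
        ‖expMean P t η - expMean P t' η‖ ≤ B * X * (|(t : ℝ) - t'| / 2 ^ n) := by
      intro t ht t' ht'
      refine (norm_expMean_sub_le_of_dist (c := (P.eval 0 : ℤ) * η)
        (B := C * 2 ^ (e + 1) * X) (by positivity) (fun m hm1 hm2 => ?_) ht ht').trans (le_of_eq ?_)
      · rw [← sub_mul, abs_mul]
        have hm : (m : ℝ) ≤ 2 * 2 ^ n := by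
          rw [pow_succ'] at hm2; exact_mod_cast hm2
        calc _ ≤ C * (m : ℝ) ^ (e + 1) * |η| := by gcongr; exact h1 m hm1
          _ ≤ C * (2 * 2 ^ n) ^ (e + 1) * |η| := by gcongr
          _ = _ := by rw [hX, mul_pow]; ring
      · rw [hB]; ring
    refine (dyadicEnergy_le (K := B) (Y := X) hB0.le hX0 (fun t ht t' ht' => ?_)
      (fun t ht t' ht' => ?_)).trans ?_
    · refine (hb1 t ht t' ht').trans ?_
      gcongr
      exact mul_le_of_le_one_right hB0.le hX1
    · refine (hb1 t ht t' ht').trans ?_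
      exact mul_le_of_le_one_right (by positivity) (abs_sub_div_two_pow_le_one ht ht')
    · have hs : √X ≤ X ^ p := by
        rcases hX0.eq_or_lt with h | h
        · rw [← h, Real.sqrt_zero]; positivity
        · rw [Real.sqrt_eq_rpow]
          exact Real.rpow_le_rpow_of_exponent_ge h hX1 hp2
      have h3 : 0 ≤ 14 * (2 * K) ^ 2 * X ^ p := by positivity
      calc _ ≤ 14 * B ^ 2 * X ^ p := by gcongr
        _ ≤ _ := by linarith
  · have hX1' : 1 ≤ X := (not_le.1 hX1).le
    set Y : ℝ := X ^ (-(1 / (2 * (e + 1))) : ℝ) with hY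
    have hY0 : 0 ≤ Y := by positivity
    refine (dyadicEnergy_le (K := 2 * K) (Y := Y) (by positivity) hY0 (fun t ht t' ht' => ?_)
      (fun t ht t' ht' => ?_)).trans ?_
    · refine (norm_expMean_sub_le η ht ht').trans ?_
      gcongr; linarith
    · have u1 := hdec n hn η X hX hX1' hXZ t ht
      have u2 := hdec n hn η X hX hX1' hXZ t' ht'
      refine (norm_sub_le _ _).trans ?_
      linarith
    · have hs : √Y = X ^ (-p) := by
        rw [hY, Real.sqrt_eq_rpow, ← Real.rpow_mul hX0, hp]
        congr 1; field_simp; norm_num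
      rw [hs]
      have h3 : 0 ≤ 14 * B ^ 2 * X ^ (-p) := by positivity
      linarith

/-! ### Major arcs and summation over the scales -/

/-- Solving b α = a/q + k, with b the leading coefficient, gives denominator b q. The leading
coefficient of the phase is A b modulo b q, and its additive order is at least q since A is coprime
to q. The fraction A/(b q) need not be reduced, so Weyl's bound is used in terms of the order, not
of the modulus. -/
theorem exists_norm_gaussMean_le (P : ℤ[X]) (hd : 1 ≤ P.natDegree) (hP : 0 < P.leadingCoeff) :
    ∃ κ C : ℝ, 0 < κ ∧ 1 ≤ C ∧ ∀ (r : ℚ) (k : ℤ),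
      ‖gaussMean P (r.num + k * r.den) (P.leadingCoeff.toNat * r.den)‖
        ≤ C * (r.den : ℝ) ^ (-κ) := by
  obtain ⟨κ, C, hκ, -, hC, hb⟩ := exists_norm_sum_stdAddChar_le P.natDegree hd
  refine ⟨κ, C, hκ, hC, fun r k => ?_⟩
  set b : ℕ := P.leadingCoeff.toNat with hbdef
  have hbZ : (b : ℤ) = P.leadingCoeff := Int.toNat_of_nonneg hP.le
  have hb0 : 0 < b := by omega
  set N : ℕ := b * r.den with hN
  set A : ℤ := r.num + k * r.den with hA
  have hNpos : 0 < N := Nat.mul_pos hb0 r.den_pos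
  have : NeZero N := ⟨hNpos.ne'⟩
  set F := (Polynomial.C A * P).map (Int.castRingHom (ZMod N)) with hF
  have hFd : F.natDegree ≤ P.natDegree :=
    Polynomial.natDegree_map_le.trans (Polynomial.natDegree_C_mul_le A P)
  have hFc : F.coeff P.natDegree = ((A * b : ℤ) : ZMod N) := by
    rw [hF, Polynomial.coeff_map, Polynomial.coeff_C_mul, Polynomial.coeff_natDegree, hbZ]
    simp
  have hcop : IsCoprime (r.den : ℤ) A := by
    have h1 : IsCoprime (r.den : ℤ) r.num :=
      (Int.isCoprime_iff_gcd_eq_one.2 (by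
        have := r.reduced
        rwa [Nat.Coprime, ← Int.natAbs_natCast r.den] at this)).symm
    exact h1.add_mul_right_right k
  have hord : r.den ≤ addOrderOf (F.coeff P.natDegree) := by
    set o := addOrderOf (F.coeff P.natDegree) with ho
    have h0 : o • F.coeff P.natDegree = 0 := addOrderOf_nsmul_eq_zero _
    have h1 : (((o : ℤ) * (A * b) : ℤ) : ZMod N) = 0 := by
      rw [hFc] at h0
      push_cast at h0 ⊢
      simpa using h0
    rw [ZMod.intCast_zmod_eq_zero_iff_dvd] at h1
    have h2 : (b : ℤ) * r.den ∣ b * (o * A) := by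
      have e1 : (o : ℤ) * (A * b) = b * (o * A) := by ring
      rw [e1, hN] at h1
      exact_mod_cast h1
    have h3 : (r.den : ℤ) ∣ o * A := (mul_dvd_mul_iff_left (by exact_mod_cast hb0.ne')).1 h2
    have h4 : (r.den : ℤ) ∣ o := hcop.dvd_of_dvd_mul_right h3
    exact Nat.le_of_dvd (addOrderOf_pos _) (by exact_mod_cast h4)
  have hN0 : (0 : ℝ) < N := by exact_mod_cast hNpos
  have hden : (0 : ℝ) < r.den := by exact_mod_cast r.den_pos
  rw [gaussMean_eq, norm_mul, norm_div, norm_one, Complex.norm_natCast, one_div,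
    inv_mul_le_iff₀ hN0]
  calc _ ≤ C * N * (addOrderOf (F.coeff P.natDegree) : ℝ) ^ (-κ) := hb N F hFd
    _ ≤ C * N * (r.den : ℝ) ^ (-κ) := by
      have : (addOrderOf (F.coeff P.natDegree) : ℝ) ^ (-κ) ≤ (r.den : ℝ) ^ (-κ) :=
        Real.rpow_le_rpow_of_nonpos hden (by exact_mod_cast hord) (by linarith)
      gcongr
    _ = _ := by ring

/-- The distance from `b_d α` to `r` that enters the definition of the major arc at `r`. -/
noncomputable def arcDist (P : ℤ[X]) (α : UnitAddCircle) (r : ℚ) : ℝ :=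
  if r = 0 then ‖P.leadingCoeff • α‖ else |circleFract (P.leadingCoeff • α) - (r : ℝ)|

theorem arcDist_nonneg (P : ℤ[X]) (α : UnitAddCircle) (r : ℚ) : 0 ≤ arcDist P α r := by
  rw [arcDist]; split_ifs <;> positivity

theorem exists_eq_add_arcDist (P : ℤ[X]) (x : ℝ) (r : ℚ) :
    ∃ (k : ℤ) (θ : ℝ), |θ| = arcDist P (x : UnitAddCircle) r ∧
      (P.leadingCoeff : ℝ) * x = r + k + θ := by
  have hcoe : P.leadingCoeff • (x : UnitAddCircle)
      = ((P.leadingCoeff * x : ℝ) : UnitAddCircle) := by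
    rw [← zsmul_eq_mul]; rfl
  rw [arcDist, hcoe]
  split_ifs with h
  · refine ⟨round ((P.leadingCoeff : ℝ) * x), P.leadingCoeff * x - round ((P.leadingCoeff : ℝ) * x),
      (UnitAddCircle.norm_eq).symm, ?_⟩
    rw [h]; push_cast; ring
  · rw [circleFract_coe]
    refine ⟨⌊(P.leadingCoeff : ℝ) * x⌋, Int.fract ((P.leadingCoeff : ℝ) * x) - r, rfl, ?_⟩
    have := Int.floor_add_fract ((P.leadingCoeff : ℝ) * x)
    linarith

/-- Modulo 1, distinct fractions with denominators below 2^(s+1) are more than 4^{-(s+1)} apart.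
Clearing denominators in r - r' + j gives an integer of absolute value below 1, and j = 0 because
both fractions lie in [0, 1). -/
theorem eq_of_mem_rationalLevel {P : ℤ[X]} {x : ℝ} {s : ℕ} {r r' : ℚ} (hr : r ∈ rationalLevel s)
    (hr' : r' ∈ rationalLevel s) {ρ : ℝ} (hρ : 2 * ρ * 4 ^ (s + 1) ≤ 1)
    (h : arcDist P (x : UnitAddCircle) r < ρ) (h' : arcDist P (x : UnitAddCircle) r' < ρ) :
    r = r' := by
  obtain ⟨k, θ, hθ, hx⟩ := exists_eq_add_arcDist P x r
  obtain ⟨k', θ', hθ', hx'⟩ := exists_eq_add_arcDist P x r'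
  rw [← hθ] at h
  rw [← hθ'] at h'
  set j : ℤ := k - k' with hj
  set z : ℚ := r - r' + j with hz
  have hzθ : (z : ℝ) = θ' - θ := by rw [hz, hj]; push_cast; linarith
  have hzlt : |(z : ℝ)| < 2 * ρ := by
    rw [hzθ]
    have := abs_sub θ' θ
    linarith
  have hden : ((r.den * r'.den : ℕ) : ℝ) ≤ 4 ^ (s + 1) := by
    have h1 := hr.2.2.2.le
    have h2 := hr'.2.2.2.le
    have h3 : r.den * r'.den ≤ 2 ^ (s + 1) * 2 ^ (s + 1) := Nat.mul_le_mul h1 h2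
    have h4 : 2 ^ (s + 1) * 2 ^ (s + 1) = 4 ^ (s + 1) := by rw [← mul_pow]; norm_num
    rw [h4] at h3
    exact_mod_cast h3
  have hint : z * (r.den * r'.den : ℚ) =
      ((r.num * r'.den - r'.num * r.den + j * r.den * r'.den : ℤ) : ℚ) := by
    have e1 := Rat.mul_den_eq_num r
    have e2 := Rat.mul_den_eq_num r'
    push_cast
    rw [← e1, ← e2, hz]; ring
  set I : ℤ := r.num * r'.den - r'.num * r.den + j * r.den * r'.den with hI
  have hIlt : |(I : ℝ)| < 1 := by
    have hdpos : (0 : ℝ) < ((r.den * r'.den : ℕ) : ℝ) := by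
      exact_mod_cast Nat.mul_pos r.den_pos r'.den_pos
    have e3 : (I : ℝ) = (z : ℝ) * ((r.den * r'.den : ℕ) : ℝ) := by
      have : ((I : ℚ) : ℝ) = ((z * (r.den * r'.den : ℚ) : ℚ) : ℝ) := by rw [hint]
      push_cast at this ⊢
      exact this
    rw [e3, abs_mul, abs_of_pos hdpos]
    have hρ0 : 0 < 2 * ρ := (abs_nonneg _).trans_lt hzlt
    calc _ < 2 * ρ * ((r.den * r'.den : ℕ) : ℝ) := by gcongr
      _ ≤ 2 * ρ * 4 ^ (s + 1) := by gcongr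
      _ ≤ 1 := hρ
  have hI0 : I = 0 := Int.abs_lt_one_iff.1 (by exact_mod_cast hIlt)
  have hz0 : z = 0 := by
    rw [hI0] at hint
    have hne : (r.den * r'.den : ℚ) ≠ 0 := by
      have := r.den_pos; have := r'.den_pos; positivity
    simpa [hne] using hint
  have hj0 : j = 0 := by
    have hjr : (j : ℚ) = r' - r := by linarith
    have h1 : |(j : ℚ)| < 1 := by
      rw [hjr, abs_lt]
      constructor <;> linarith [hr.1, hr.2.1, hr'.1, hr'.2.1]
    exact Int.abs_lt_one_iff.1 (by exact_mod_cast h1)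
  rw [hz, hj0] at hz0
  push_cast at hz0
  linarith

theorem exists_tsum_decayProfile_le {p : ℝ} (hp : 0 < p) (e : ℕ) :
    ∃ C : ℝ≥0, ∀ β : ℝ, 0 ≤ β →
      ∑' n : ℕ, ENNReal.ofReal (decayProfile p (β * ((2 : ℝ) ^ n) ^ (e + 1))) ≤ C := by
  set σ : ℝ := (2 : ℝ) ^ (-p) with hσ
  have hσ0 : 0 < σ := by positivity
  have hσ1 : σ < 1 := Real.rpow_lt_one_of_one_lt_of_neg one_lt_two (by linarith)
  have hsum : Summable fun j : ℤ => (2 : ℝ) ^ p * σ ^ j.natAbs := by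
    refine Summable.mul_left _ (Summable.of_nat_of_neg ?_ ?_)
    · simpa using summable_geometric_of_lt_one hσ0.le hσ1
    · simpa using summable_geometric_of_lt_one hσ0.le hσ1
  have hfin : ∑' j : ℤ, ENNReal.ofReal ((2 : ℝ) ^ p * σ ^ j.natAbs) ≠ ∞ := by
    rw [← ENNReal.ofReal_tsum_of_nonneg (fun _ => by positivity) hsum]
    exact ENNReal.ofReal_ne_top
  refine ⟨(∑' j : ℤ, ENNReal.ofReal ((2 : ℝ) ^ p * σ ^ j.natAbs)).toNNReal, fun β hβ => ?_⟩
  rw [ENNReal.coe_toNNReal hfin]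
  rcases hβ.eq_or_lt with rfl | hβ0
  · have : decayProfile p 0 = 0 := by simp [decayProfile, Real.zero_rpow hp.ne']
    simp [this]
  set y : ℝ := Real.logb 2 β with hy
  have hβy : β = (2 : ℝ) ^ y := (Real.rpow_logb two_pos (by norm_num) hβ0).symm
  -- The integer part of log₂ X at scale n. It is injective in n, so the sum is dominated by one
  -- two-sided geometric series independent of β; rounding costs the factor 2^p.
  set φ : ℕ → ℤ := fun n => ⌊y⌋ + n * (e + 1) with hφ
  have hinj : Function.Injective φ := fun n m h => by
    simp only [hφ, add_right_inj] at h
    have := mul_right_cancel₀ (by positivity) h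
    exact_mod_cast this
  refine le_trans (ENNReal.tsum_le_tsum fun n => ?_)
    (ENNReal.tsum_comp_le_tsum_of_injective hinj _)
  refine ENNReal.ofReal_le_ofReal ?_
  set w : ℝ := y + n * (e + 1) with hw
  have hX : β * ((2 : ℝ) ^ n) ^ (e + 1) = (2 : ℝ) ^ w := by
    rw [hβy, hw, Real.rpow_add two_pos, ← pow_mul]
    congr 1
    rw [← Real.rpow_natCast]; push_cast; rfl
  have h1 : decayProfile p ((2 : ℝ) ^ w) ≤ (2 : ℝ) ^ (-(p * |w|)) := by
    rw [decayProfile]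
    split_ifs with h
    · have hw0 : w ≤ 0 := by
        by_contra hc
        exact absurd h (not_le.2 (Real.one_lt_rpow one_lt_two (not_le.1 hc)))
      rw [← Real.rpow_mul two_pos.le, abs_of_nonpos hw0]
      exact le_of_eq (by congr 1; ring)
    · have hw0 : 0 ≤ w := by
        by_contra hc
        exact h (Real.rpow_le_one_of_one_le_of_nonpos one_le_two (not_le.1 hc).le)
      rw [← Real.rpow_mul two_pos.le, abs_of_nonneg hw0]
      exact le_of_eq (by congr 1; ring)
  have h2 : ((φ n).natAbs : ℝ) ≤ |w| + 1 := by
    have e1 : ((φ n).natAbs : ℝ) = |((φ n : ℤ) : ℝ)| := by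
      rw [Nat.cast_natAbs]; push_cast; rfl
    have e2 : ((φ n : ℤ) : ℝ) = w - Int.fract y := by
      simp only [hφ, hw]
      push_cast
      have := Int.floor_add_fract y
      linarith
    rw [e1, e2]
    refine (abs_sub _ _).trans ?_
    rw [abs_of_nonneg (Int.fract_nonneg y)]
    linarith [Int.fract_lt_one y]
  rw [hX]
  refine h1.trans ?_
  rw [hσ, ← Real.rpow_natCast, ← Real.rpow_mul two_pos.le, ← Real.rpow_add two_pos]
  refine Real.rpow_le_rpow_of_exponent_le one_le_two ?_
  nlinarith

/-- The factor τ^s comes from the squared Gauss sum, the profile from the mean at η, and σ^n from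
the error of the product approximation. -/
theorem exists_dyadicEnergy_majorArc_le (P : ℤ[X]) {e : ℕ} (hd : P.natDegree = e + 1)
    (hP : 0 < P.leadingCoeff) {δ : ℝ} (hδ1 : δ < 1 / 10) :
    ∃ (K p τ σ : ℝ) (n₀ : ℕ), 0 < K ∧ 0 < p ∧ 0 < τ ∧ τ < 1 ∧ 0 < σ ∧ σ < 1 ∧
      ∀ n ≥ n₀, ∀ (s : ℕ) (r : ℚ), (s : ℝ) ≤ n * δ → r ∈ rationalLevel s → ∀ x : ℝ,
        arcDist P (x : UnitAddCircle) r < (2 : ℝ) ^ (-((n : ℝ) * ((P.natDegree : ℝ) - δ))) →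
        dyadicEnergy n (fun t => expMean P t x) ≤
          K * (τ ^ s * decayProfile p (arcDist P (x : UnitAddCircle) r / P.leadingCoeff *
            ((2 : ℝ) ^ n) ^ (e + 1)) + σ ^ n) := by
  obtain ⟨κ, G, hκ, hG, hgauss⟩ := exists_norm_gaussMean_le P (by omega) hP
  obtain ⟨K, p, n₀, hK, hp, hmain⟩ := exists_dyadicEnergy_expMean_le_decayProfile P hd hP
  obtain ⟨C, -, hC, -, hinc, -⟩ := exists_poly_increment_bounds P hd hP
  have hb1 : (1 : ℝ) ≤ P.leadingCoeff := by exact_mod_cast hP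
  set b : ℝ := (P.leadingCoeff : ℝ) with hb
  have hb0 : 0 < b := by linarith
  set B : ℝ := 4 * b * (1 + 2 * Real.pi * (C * 2 ^ (e + 1))) with hB
  have hB0 : 0 < B := by positivity
  refine ⟨2 * G ^ 2 * K + 28 * (4 + 2 * B) ^ 2, p, (2 : ℝ) ^ (-(2 * κ)), (2 : ℝ) ^ (-(2 / 5) : ℝ),
    n₀, by positivity, hp, by positivity, Real.rpow_lt_one_of_one_lt_of_neg one_lt_two (by linarith),
    by positivity, Real.rpow_lt_one_of_one_lt_of_neg one_lt_two (by norm_num),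
    fun n hn s r hs hr x hx => ?_⟩
  obtain ⟨k, θ, hθ, hxe⟩ := exists_eq_add_arcDist P x r
  set β : ℝ := arcDist P (x : UnitAddCircle) r with hβ
  set Z : ℝ := (2 : ℝ) ^ n with hZ
  have hZ1 : 1 ≤ Z := one_le_pow₀ one_le_two
  have hZ0 : 0 < Z := by linarith
  set N : ℕ := P.leadingCoeff.toNat * r.den with hN
  set A : ℤ := r.num + k * r.den with hA
  have hbN : ((P.leadingCoeff.toNat : ℕ) : ℝ) = b := by
    have : ((P.leadingCoeff.toNat : ℕ) : ℤ) = P.leadingCoeff := Int.toNat_of_nonneg hP.le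
    rw [hb, ← Int.cast_natCast, this]
  have hden0 : (0 : ℝ) < r.den := by exact_mod_cast r.den_pos
  have hNr : (N : ℝ) = b * r.den := by rw [hN]; push_cast; rw [hbN]
  have hN1 : 1 ≤ N := Nat.mul_pos (by omega) r.den_pos
  set η : ℝ := θ / b with hη
  have hxA : x = (A : ℝ) / N + η := by
    have hrq : (r : ℝ) * r.den = r.num := by exact_mod_cast Rat.mul_den_eq_num r
    have hA' : (A : ℝ) = ((r : ℝ) + k) * r.den := by
      rw [hA]; push_cast; rw [← hrq]; ring
    rw [hNr, hη, hA', mul_div_mul_right _ _ hden0.ne', ← add_div, eq_div_iff hb0.ne', mul_comm]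
    exact hxe
  have hηβ : |η| = β / b := by rw [hη, abs_div, hθ, abs_of_pos hb0]
  set X : ℝ := |η| * Z ^ (e + 1) with hX
  have hZd : Z ^ δ ≤ Z ^ (1 / 10 : ℝ) := Real.rpow_le_rpow_of_exponent_le hZ1 hδ1.le
  have hX0 : 0 ≤ X := by positivity
  have hXZ : X ≤ Z ^ (1 / 10 : ℝ) := by
    refine le_trans ?_ hZd
    have h1 : |η| ≤ (2 : ℝ) ^ (-((n : ℝ) * ((P.natDegree : ℝ) - δ))) := by
      rw [hηβ]
      exact (div_le_self (arcDist_nonneg _ _ _) hb1).trans hx.le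
    calc X ≤ (2 : ℝ) ^ (-((n : ℝ) * ((P.natDegree : ℝ) - δ))) * Z ^ (e + 1) :=
          mul_le_mul_of_nonneg_right h1 (by positivity)
      _ = Z ^ δ := by
        rw [hZ, ← Real.rpow_natCast 2 n, ← Real.rpow_natCast _ (e + 1), ← Real.rpow_mul two_pos.le,
          ← Real.rpow_add two_pos, ← Real.rpow_mul two_pos.le, hd]
        congr 1; push_cast; ring
  have h2s : (2 : ℝ) ^ s ≤ Z ^ (1 / 10 : ℝ) := by
    refine le_trans ?_ hZd
    rw [hZ, ← Real.rpow_natCast 2 n, ← Real.rpow_natCast 2 s, ← Real.rpow_mul two_pos.le]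
    exact Real.rpow_le_rpow_of_exponent_le one_le_two hs
  have hNle : (N : ℝ) ≤ 2 * b * Z ^ (1 / 10 : ℝ) := by
    have : (r.den : ℝ) ≤ 2 * 2 ^ s := by
      have := hr.2.2.2.le
      rw [pow_succ'] at this
      exact_mod_cast this
    calc (N : ℝ) = b * r.den := hNr
      _ ≤ b * (2 * Z ^ (1 / 10 : ℝ)) := by gcongr; linarith
      _ = _ := by ring
  set S : ℂ := gaussMean P A N with hS
  have hS1 : ‖S‖ ≤ 1 := norm_expMean_le_one P hN1 _
  have hSτ : ‖S‖ ^ 2 ≤ G ^ 2 * ((2 : ℝ) ^ (-(2 * κ))) ^ s := by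
    have h1 : ‖S‖ ≤ G * ((2 : ℝ) ^ s) ^ (-κ) := by
      refine (hgauss r k).trans ?_
      have : (r.den : ℝ) ^ (-κ) ≤ ((2 : ℝ) ^ s) ^ (-κ) :=
        Real.rpow_le_rpow_of_nonpos (by positivity) (by exact_mod_cast hr.2.2.1) (by linarith)
      gcongr
    calc ‖S‖ ^ 2 ≤ (G * ((2 : ℝ) ^ s) ^ (-κ)) ^ 2 := by gcongr
      _ = _ := by
        rw [mul_pow]
        congr 1
        simp only [← Real.rpow_natCast, ← Real.rpow_mul two_pos.le]
        congr 1; push_cast; ring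
  -- As δ < 1/10, both N and 1 + t D|η| are O(Z^{1/10}), so the approximation error is O(Z^{1/10 +
  -- 1/10 - 1}). Its square root produces σ = 2^{-2/5}.
  set W : ℝ := Z ^ (-(4 / 5) : ℝ) with hW
  have hW0 : 0 ≤ W := by positivity
  have hZW : Z ^ (1 / 10 : ℝ) * Z ^ (1 / 10 : ℝ) = W * Z := by
    rw [hW, ← Real.rpow_add hZ0, ← Real.rpow_add_one hZ0.ne']; norm_num
  set E : ℕ → ℂ := fun t => expMean P t x - S * expMean P t η with hE
  have hEle : ∀ t ∈ Set.Icc (2 ^ n) (2 ^ (n + 1)), ‖E t‖ ≤ B * W := by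
    intro t ht
    have htZ : Z ≤ t := by rw [hZ]; exact_mod_cast ht.1
    have htZ2 : (t : ℝ) ≤ 2 * Z := by
      have := ht.2
      rw [pow_succ'] at this
      rw [hZ]; exact_mod_cast this
    have ht0 : (0 : ℝ) < t := by linarith
    have ht1 : 1 ≤ t := by exact_mod_cast ht0
    have := norm_expMean_add_sub_le P A hN1 η ht1 (D := C * (2 * Z) ^ e) (fun m hm1 hm2 => by
      refine (hinc m hm1).trans ?_
      gcongr
      exact le_trans (by exact_mod_cast hm2) htZ2)
    rw [← hxA] at this
    refine this.trans ?_
    have hZt1 : 1 ≤ Z ^ (1 / 10 : ℝ) := Real.one_le_rpow hZ1 (by norm_num)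
    have h1 : t * (2 * Real.pi * (C * (2 * Z) ^ e * |η|))
        ≤ 2 * Real.pi * (C * 2 ^ (e + 1)) * Z ^ (1 / 10 : ℝ) := by
      calc _ ≤ (2 * Z) * (2 * Real.pi * (C * (2 * Z) ^ e * |η|)) := by gcongr
        _ = 2 * Real.pi * (C * 2 ^ (e + 1)) * X := by rw [hX, mul_pow]; ring
        _ ≤ _ := by gcongr
    have h2 : 1 + t * (2 * Real.pi * (C * (2 * Z) ^ e * |η|))
        ≤ (1 + 2 * Real.pi * (C * 2 ^ (e + 1))) * Z ^ (1 / 10 : ℝ) := by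
      rw [add_mul, one_mul]; exact add_le_add hZt1 h1
    calc _ ≤ 2 * (2 * b * Z ^ (1 / 10 : ℝ)) *
          ((1 + 2 * Real.pi * (C * 2 ^ (e + 1))) * Z ^ (1 / 10 : ℝ)) / Z := by gcongr
      _ = B * (Z ^ (1 / 10 : ℝ) * Z ^ (1 / 10 : ℝ)) / Z := by rw [hB]; ring
      _ = _ := by rw [hZW]; field_simp
  -- The factor 4 + 2 B covers both the Lipschitz constant 2 + 2 and the uniform bound 2 B W.
  have hEen : dyadicEnergy n E ≤ 14 * (4 + 2 * B) ^ 2 * √W := by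
    refine dyadicEnergy_le (by positivity) hW0 (fun t ht t' ht' => ?_) (fun t ht t' ht' => ?_)
    · have h1 := norm_expMean_sub_le (P := P) x ht ht'
      have h2 := norm_expMean_sub_le (P := P) η ht ht'
      have hid : E t - E t' = (expMean P t x - expMean P t' x) -
          S * (expMean P t η - expMean P t' η) := by simp only [hE]; ring
      have h3 : ‖S * (expMean P t η - expMean P t' η)‖ ≤ 1 * (2 * (|(t : ℝ) - t'| / 2 ^ n)) := by
        rw [norm_mul]; gcongr
      have h4 : 0 ≤ 2 * B * (|(t : ℝ) - t'| / 2 ^ n) := by positivity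
      rw [hid]
      refine (norm_sub_le _ _).trans ?_
      linarith
    · refine (norm_sub_le _ _).trans ?_
      have := hEle t ht
      have := hEle t' ht'
      linarith
  have hsW : √W = ((2 : ℝ) ^ (-(2 / 5) : ℝ)) ^ n := by
    rw [hW, hZ, Real.sqrt_eq_rpow]
    simp only [← Real.rpow_natCast, ← Real.rpow_mul two_pos.le]
    congr 1; ring
  have hdecomp : dyadicEnergy n (fun t => expMean P t x) ≤
      2 * (‖S‖ ^ 2 * dyadicEnergy n (fun t => expMean P t η)) + 2 * dyadicEnergy n E := by
    rw [← dyadicEnergy_const_mul]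
    refine le_trans (le_of_eq ?_) (dyadicEnergy_add_le n _ _)
    congr 1; funext t; simp only [hE]; ring
  have hven := hmain n hn η X hX hXZ
  rw [hsW] at hEen
  have hXβ : β / b * Z ^ (e + 1) = X := by rw [hX, hηβ]
  rw [hXβ]
  set T : ℝ := ((2 : ℝ) ^ (-(2 * κ))) ^ s with hT
  set U : ℝ := ((2 : ℝ) ^ (-(2 / 5) : ℝ)) ^ n with hU
  have hT0 : 0 ≤ T := by positivity
  have hU0 : 0 ≤ U := by positivity
  have hD0 := decayProfile_nonneg p hX0
  have hprod : ‖S‖ ^ 2 * dyadicEnergy n (fun t => expMean P t η)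
      ≤ (G ^ 2 * T) * (K * decayProfile p X) :=
    mul_le_mul hSτ hven (dyadicEnergy_nonneg _ _) (by positivity)
  have q1 : 0 ≤ 28 * (4 + 2 * B) ^ 2 * (T * decayProfile p X) := by positivity
  have q2 : 0 ≤ 2 * G ^ 2 * K * U := by positivity
  calc _ ≤ 2 * ((G ^ 2 * T) * (K * decayProfile p X)) + 2 * (14 * (4 + 2 * B) ^ 2 * U) := by
        linarith
    _ ≤ _ := by
      rw [mul_add, add_mul, add_mul]
      linarith

/-- The total dyadic energy of the multipliers over all scales whose major arcs contain a given
frequency is bounded. -/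
theorem exists_tsum_dyadicEnergy_le (P : ℤ[X]) {e : ℕ} (hd : P.natDegree = e + 1)
    (hP : 0 < P.leadingCoeff) {δ : ℝ} (hδ1 : δ < 1 / 10) :
    ∃ C : ℝ≥0, ∀ x : ℝ, ∑' n : ℕ, (majorArcs P δ n).indicator
      (fun _ => ENNReal.ofReal (dyadicEnergy n (fun t => expMean P t x))) (x : UnitAddCircle)
        ≤ C := by
  obtain ⟨K, p, τ, σ, n₀, hK, hp, hτ, hτ1, hσ, hσ1, hmain⟩ :=
    exists_dyadicEnergy_majorArc_le P hd hP hδ1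
  obtain ⟨C₁, hC₁⟩ := exists_tsum_decayProfile_le hp e
  have hfinσ : ∑' n : ℕ, ENNReal.ofReal (K * σ ^ n) ≠ ∞ := by
    rw [← ENNReal.ofReal_tsum_of_nonneg (fun _ => by positivity)
      ((summable_geometric_of_lt_one hσ.le hσ1).mul_left K)]
    exact ENNReal.ofReal_ne_top
  have hfinτ : ∑' s : ℕ, ENNReal.ofReal (K * τ ^ s) ≠ ∞ := by
    rw [← ENNReal.ofReal_tsum_of_nonneg (fun _ => by positivity)
      ((summable_geometric_of_lt_one hτ.le hτ1).mul_left K)]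
    exact ENNReal.ofReal_ne_top
  -- From n = 5 on, s ≤ nδ and δ < 1/10 give 2s + 3 ≤ n(1 - δ), so the arcs are narrow enough for
  -- the separation of fractions. Each earlier scale costs at most 56.
  set n₁ : ℕ := max n₀ 5 with hn₁
  set Ctot : ℝ≥0∞ := (n₁ : ℝ≥0∞) * 56 + (∑' s : ℕ, ENNReal.ofReal (K * τ ^ s)) * C₁ +
    ∑' n : ℕ, ENNReal.ofReal (K * σ ^ n) with hCtot
  have hCfin : Ctot ≠ ∞ := by
    refine ENNReal.add_ne_top.2 ⟨ENNReal.add_ne_top.2 ⟨?_, ?_⟩, hfinσ⟩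
    · exact ENNReal.mul_ne_top (ENNReal.natCast_ne_top _) (by norm_num)
    · exact ENNReal.mul_ne_top hfinτ ENNReal.coe_ne_top
  refine ⟨Ctot.toNNReal, fun x => ?_⟩
  rw [ENNReal.coe_toNNReal hCfin]
  set Q : ℕ → ℚ → Prop := fun s r => r ∈ rationalLevel s ∧
    arcDist P (x : UnitAddCircle) r * (2 * 4 ^ (s + 1)) < 1 with hQ
  have huniq : ∀ s r r', Q s r → Q s r' → r = r' := by
    intro s r r' h h'
    have hpos : (0 : ℝ) < 2 * 4 ^ (s + 1) := by positivity
    refine eq_of_mem_rationalLevel (P := P) (x := x) (ρ := 1 / (2 * 4 ^ (s + 1))) h.1 h'.1 ?_ ?_ ?_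
    · refine le_of_eq ?_; field_simp
    · rw [lt_div_iff₀ hpos]; exact h.2
    · rw [lt_div_iff₀ hpos]; exact h'.2
  classical
  -- The distance to the unique candidate of level s, independent of n, so that the sum over n can
  -- be taken first. The default 0 is harmless: those levels only need a nonnegative term.
  set β : ℕ → ℝ := fun s => if h : ∃ r, Q s r then arcDist P (x : UnitAddCircle) h.choose else 0
    with hβ
  have hβQ : ∀ s r, Q s r → β s = arcDist P (x : UnitAddCircle) r := by
    intro s r h
    have hex : ∃ r, Q s r := ⟨r, h⟩
    simp only [hβ, dif_pos hex]
    rw [huniq s _ _ hex.choose_spec h]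
  have hβ0 : ∀ s, 0 ≤ β s := fun s => by
    simp only [hβ]; split_ifs
    · exact arcDist_nonneg _ _ _
    · exact le_rfl
  have hb1 : (1 : ℝ) ≤ P.leadingCoeff := by exact_mod_cast hP
  set g : ℕ → ℕ → ℝ≥0∞ := fun s n => ENNReal.ofReal (K * τ ^ s) *
    ENNReal.ofReal (decayProfile p (β s / P.leadingCoeff * ((2 : ℝ) ^ n) ^ (e + 1))) with hg
  have hterm : ∀ n : ℕ, (majorArcs P δ n).indicator
      (fun _ => ENNReal.ofReal (dyadicEnergy n (fun t => expMean P t x))) (x : UnitAddCircle)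
        ≤ (if n ∈ Finset.range n₁ then 56 else 0) + ∑' s, g s n + ENNReal.ofReal (K * σ ^ n) := by
    intro n
    by_cases hmem : (x : UnitAddCircle) ∈ majorArcs P δ n
    swap
    · rw [Set.indicator_of_notMem hmem]; exact zero_le
    rw [Set.indicator_of_mem hmem]
    by_cases hn : n ∈ Finset.range n₁
    · rw [if_pos hn]
      refine le_trans ?_ (le_trans le_self_add le_self_add)
      refine (ENNReal.ofReal_le_ofReal (dyadicEnergy_expMean_le P n x)).trans ?_
      norm_num
    · rw [if_neg hn, zero_add]
      have hn' : n₁ ≤ n := by simpa using hn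
      have hn5 : (5 : ℝ) ≤ n := by exact_mod_cast (le_max_right _ _).trans hn'
      simp only [majorArcs, Set.mem_iUnion, exists_prop] at hmem
      obtain ⟨s, hs, r, hr, harc⟩ := hmem
      have harc' : arcDist P (x : UnitAddCircle) r
        < (2 : ℝ) ^ (-((n : ℝ) * ((P.natDegree : ℝ) - δ))) := harc
      have hQsr : Q s r := by
        refine ⟨hr, ?_⟩
        have h4 : (2 * 4 ^ (s + 1) : ℝ) = (2 : ℝ) ^ (2 * (s : ℝ) + 3) := by
          have : (2 * 4 ^ (s + 1) : ℝ) = (2 : ℝ) ^ (2 * s + 3) := by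
            have : (4 : ℝ) = 2 ^ 2 := by norm_num
            rw [this, ← pow_mul]; ring
          rw [this, ← Real.rpow_natCast]; push_cast; rfl
        rw [h4]
        calc _ < (2 : ℝ) ^ (-((n : ℝ) * ((P.natDegree : ℝ) - δ))) * (2 : ℝ) ^ (2 * (s : ℝ) + 3) := by
              gcongr
          _ = (2 : ℝ) ^ (-((n : ℝ) * ((P.natDegree : ℝ) - δ)) + (2 * (s : ℝ) + 3)) := by
              rw [← Real.rpow_add two_pos]
          _ ≤ 1 := by
              refine Real.rpow_le_one_of_one_le_of_nonpos one_le_two ?_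
              rw [hd]
              have he : (0 : ℝ) ≤ e := Nat.cast_nonneg e
              push_cast
              have := mul_nonneg (by linarith : (0 : ℝ) ≤ n) he
              nlinarith
      have hb := hmain n ((le_max_left _ _).trans hn') s r hs hr x harc'
      rw [← hβQ s r hQsr] at hb
      have hD0 : 0 ≤ decayProfile p (β s / P.leadingCoeff * ((2 : ℝ) ^ n) ^ (e + 1)) :=
        decayProfile_nonneg _ (by have := hβ0 s; positivity)
      refine (ENNReal.ofReal_le_ofReal hb).trans ?_
      rw [mul_add, ← mul_assoc, ENNReal.ofReal_add (by positivity) (by positivity),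
        ENNReal.ofReal_mul (by positivity)]
      gcongr
      exact ENNReal.le_tsum (f := fun s => g s n) s
  refine (ENNReal.tsum_le_tsum hterm).trans ?_
  rw [ENNReal.tsum_add, ENNReal.tsum_add, hCtot]
  gcongr
  · rw [tsum_eq_sum (s := Finset.range n₁) (fun n hn => if_neg hn), Finset.sum_ite_mem]
    simp
  · rw [ENNReal.tsum_comm, ← ENNReal.tsum_mul_right]
    refine ENNReal.tsum_le_tsum fun s => ?_
    simp only [hg]
    rw [ENNReal.tsum_mul_left]
    gcongr
    exact hC₁ _ (by have := hβ0 s; positivity)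

open MeasureTheory AddCircle

theorem exists_tsum_dyadicEnergy_le_of_leadingCoeff_pos (P : ℤ[X]) (hP : 0 < P.leadingCoeff)
    {δ : ℝ} (hδ1 : δ < 1 / 10) :
    ∃ C : ℝ≥0, ∀ x : ℝ, ∑' n : ℕ, (majorArcs P δ n).indicator
      (fun _ => ENNReal.ofReal (dyadicEnergy n (fun t => expMean P t x))) (x : UnitAddCircle)
        ≤ C := by
  rcases Nat.eq_zero_or_pos P.natDegree with h0 | hpos
  · refine ⟨0, fun x => le_of_eq ?_⟩
    have hconst : ∀ n, ∀ t ∈ Set.Icc (2 ^ n) (2 ^ (n + 1)), expMean P t x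
        = expo ((P.coeff 0 : ℤ) * x) := by
      intro n t ht
      rw [expMean, Polynomial.eq_C_of_natDegree_eq_zero h0]
      simp only [Polynomial.eval_C, Polynomial.coeff_C_zero]
      exact natAvg_const _ (Nat.one_le_two_pow.trans ht.1)
    have hz : ∀ n, dyadicEnergy n (fun t => expMean P t x) = 0 := by
      intro n
      refine le_antisymm ?_ (dyadicEnergy_nonneg _ _)
      have := dyadicEnergy_le (n := n) (a := fun t => expMean P t x) (K := 0) (Y := 0) le_rfl le_rfl
        (fun t ht t' ht' => by simp [hconst n t ht, hconst n t' ht'])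
        (fun t ht t' ht' => by simp [hconst n t ht, hconst n t' ht'])
      simpa using this
    simp [hz]
  · obtain ⟨e, he⟩ : ∃ e, P.natDegree = e + 1 := ⟨P.natDegree - 1, by omega⟩
    exact exists_tsum_dyadicEnergy_le P he hP hδ1

/-! ### Plancherel: from the integers to the circle -/

theorem measurable_circleFract : Measurable circleFract :=
  measurable_subtype_coe.comp (AddCircle.measurableEquivIco (1 : ℝ) 0).measurable

theorem measurableSet_majorArcs (P : ℤ[X]) (δ : ℝ) (n : ℕ) : MeasurableSet (majorArcs P δ n) := by
  refine MeasurableSet.iUnion fun s => MeasurableSet.iUnion fun _ => MeasurableSet.iUnion fun r =>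
    MeasurableSet.iUnion fun _ => ?_
  have hsm : Measurable fun α : UnitAddCircle => P.leadingCoeff • α :=
    (continuous_zsmul P.leadingCoeff).measurable
  refine measurableSet_lt ?_ measurable_const
  by_cases h : r = 0
  · simp only [h, if_true]
    exact hsm.norm
  · simp only [h, if_false]
    exact ((measurable_circleFract.comp hsm).sub_const _).abs

/-- The multiplier of the polynomial mean on the circle. -/
noncomputable def circMean (P : ℤ[X]) (t : ℕ) (α : UnitAddCircle) : ℂ :=
  natAvg (fun m => (fourier (P.eval (m : ℤ)) α : ℂ)) t

theorem circMean_coe (P : ℤ[X]) (t : ℕ) (x : ℝ) : circMean P t (x : UnitAddCircle)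
    = expMean P t x := by
  rw [circMean, expMean]
  congr 1
  funext m
  rw [fourier_coe_apply, expo]
  congr 1; push_cast; ring

theorem continuous_circMean (P : ℤ[X]) (t : ℕ) : Continuous (circMean P t) := by
  unfold circMean natAvg
  fun_prop

theorem polyMean_eq_natAvg (P : ℤ[X]) (t : ℕ) (g : ℤ → ℂ) (x : ℤ) :
    polyMean P t g x = natAvg (fun m => g (x + P.eval (m : ℤ))) t := by
  rw [polyMean, natAvg]
  congr 1
  induction t with
  | zero => simp
  | succ t ih => rw [Finset.sum_Icc_succ_top (by omega), ih, Finset.sum_range_succ]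

theorem integrable_latticeFourier (f : EllTwo) :
    Integrable (latticeFourier f) (haarAddCircle : Measure UnitAddCircle) :=
  (Lp.memLp (latticeFourier f)).integrable (by norm_num)

theorem integrable_continuous_mul_latticeFourier {w : UnitAddCircle → ℂ} (hw : Continuous w)
    (f : EllTwo) :
    Integrable (fun α => w α * latticeFourier f α) (haarAddCircle : Measure UnitAddCircle) := by
  obtain ⟨C, hC⟩ := isCompact_univ.exists_bound_of_continuousOn hw.continuousOn
  exact (integrable_latticeFourier f).bdd_mul hw.aestronglyMeasurable
    (ae_of_all _ fun α => hC α (Set.mem_univ α))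

theorem polyMean_freqProj (P : ℤ[X]) (D : Set UnitAddCircle) (f : EllTwo) (t : ℕ) (x : ℤ) :
    polyMean P t (freqProj D f) x =
      ∫ α in D, (fourier x α : ℂ) * (circMean P t α * latticeFourier f α) ∂haarAddCircle := by
  rw [polyMean_eq_natAvg, natAvg]
  simp only [freqProj]
  rw [← integral_finsetSum, ← integral_const_mul]
  · congr 1
    funext α
    rw [circMean, natAvg, Finset.mul_sum, Finset.mul_sum, Finset.sum_mul, Finset.mul_sum]
    refine Finset.sum_congr rfl fun i _ => ?_
    rw [fourier_add]; ring
  · intro i _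
    exact (integrable_continuous_mul_latticeFourier (by fun_prop) f).integrableOn

theorem tsum_enorm_sq_fourierCoeff {h : UnitAddCircle → ℂ}
    (hh : MemLp h 2 (haarAddCircle : Measure UnitAddCircle)) :
    ∑' i : ℤ, ‖fourierCoeff h i‖ₑ ^ 2 = ∫⁻ α, ‖h α‖ₑ ^ 2 ∂haarAddCircle := by
  have hs := hasSum_sq_fourierCoeff hh.toLp
  have hc : ∀ i, fourierCoeff (hh.toLp h) i = fourierCoeff h i := fun i =>
    congrFun (fourierCoeff_congr_ae hh.coeFn_toLp) i
  have hint : ∫ α, ‖hh.toLp h α‖ ^ 2 ∂haarAddCircle = ∫ α, ‖h α‖ ^ 2 ∂haarAddCircle := by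
    refine integral_congr_ae ?_
    filter_upwards [hh.coeFn_toLp] with α hα
    rw [hα]
  simp only [hc] at hs
  rw [hint] at hs
  have e1 : ∀ z : ℂ, ‖z‖ₑ ^ 2 = ENNReal.ofReal (‖z‖ ^ 2) := fun z => by
    rw [ENNReal.ofReal_pow (norm_nonneg _), ofReal_norm]
  simp only [e1]
  rw [← ENNReal.ofReal_tsum_of_nonneg (fun _ => by positivity) hs.summable, hs.tsum_eq,
    ofReal_integral_eq_lintegral_ofReal]
  · exact hh.integrable_norm_pow (by norm_num)
  · exact ae_of_all _ fun _ => by positivity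

theorem fourierCoeff_latticeFourier (f : EllTwo) (i : ℤ) :
    fourierCoeff (latticeFourier f) i = f (-i) := by
  rw [← fourierBasis_repr, HilbertBasis.repr_apply_apply]
  have h := (hasSum_latticeFourier f).mapL (innerSL ℂ (fourierBasis (T := (1 : ℝ)) i))
  have h2 : HasSum (fun m : ℤ => innerSL ℂ (fourierBasis (T := (1 : ℝ)) i)
      (f m • fourierLp (T := (1 : ℝ)) 2 (-m))) (f (-i)) := by
    have ho := (fourierBasis (T := (1 : ℝ))).orthonormal
    rw [orthonormal_iff_ite] at ho
    convert hasSum_single (f := fun m : ℤ => innerSL ℂ (fourierBasis (T := (1 : ℝ)) i)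
      (f m • fourierLp (T := (1 : ℝ)) 2 (-m))) (-i) (fun m hm => ?_) using 1
    · have := (fourierBasis (T := (1 : ℝ))).orthonormal.1 i
      rw [coe_fourierBasis] at this
      simp [this]
    · have := ho i (-m)
      rw [coe_fourierBasis] at this
      have hne : i ≠ -m := fun h => hm (by omega)
      simp [this, hne]
  exact h.unique h2

theorem lintegral_enorm_sq_latticeFourier (f : EllTwo) :
    ∫⁻ α, ‖latticeFourier f α‖ₑ ^ 2 ∂haarAddCircle = ellTwoNormSq (fun x => ‖f x‖ₑ) := by
  rw [← tsum_enorm_sq_fourierCoeff (Lp.memLp (latticeFourier f)), ellTwoNormSq,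
    ← (Equiv.neg ℤ).tsum_eq]
  simp [fourierCoeff_latticeFourier]

/-- The difference of means at x is the Fourier coefficient at -x of the multiplier difference times
the transform of f, cut off to D; Parseval does the rest. -/
theorem tsum_enorm_sq_polyMean_sub (P : ℤ[X]) {D : Set UnitAddCircle} (hD : MeasurableSet D)
    (f : EllTwo) (t t' : ℕ) :
    ∑' x : ℤ, ‖polyMean P t (freqProj D f) x - polyMean P t' (freqProj D f) x‖ₑ ^ 2 =
      ∫⁻ α in D, ‖circMean P t α - circMean P t' α‖ₑ ^ 2 * ‖latticeFourier f α‖ₑ ^ 2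
        ∂haarAddCircle := by
  set w : UnitAddCircle → ℂ := fun α => circMean P t α - circMean P t' α with hw
  have hwc : Continuous w := (continuous_circMean P t).sub (continuous_circMean P t')
  set h : UnitAddCircle → ℂ := D.indicator fun α => w α * latticeFourier f α with hh
  obtain ⟨C, hC⟩ := isCompact_univ.exists_bound_of_continuousOn hwc.continuousOn
  have hmem : MemLp h 2 (haarAddCircle : Measure UnitAddCircle) := by
    refine MemLp.indicator hD ?_
    refine MemLp.of_le_mul (c := C) (Lp.memLp (latticeFourier f))
      (hwc.aestronglyMeasurable.mul (Lp.aestronglyMeasurable _)) (ae_of_all _ fun α => ?_)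
    rw [norm_mul]
    gcongr
    exact hC α (Set.mem_univ α)
  have hcoeff : ∀ x : ℤ, polyMean P t (freqProj D f) x - polyMean P t' (freqProj D f) x
      = fourierCoeff h (-x) := by
    intro x
    rw [polyMean_freqProj, polyMean_freqProj, ← integral_sub, fourierCoeff, ← integral_indicator hD]
    · congr 1
      funext α
      simp only [hh, hw, Set.indicator, neg_neg, smul_eq_mul]
      split_ifs <;> ring
    · refine Integrable.integrableOn ?_
      simp only [← mul_assoc]
      exact integrable_continuous_mul_latticeFourier
        ((map_continuous (fourier x)).mul (continuous_circMean P t)) f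
    · refine Integrable.integrableOn ?_
      simp only [← mul_assoc]
      exact integrable_continuous_mul_latticeFourier
        ((map_continuous (fourier x)).mul (continuous_circMean P t')) f
  simp only [hcoeff]
  have hneg := (Equiv.neg ℤ).tsum_eq fun i => ‖fourierCoeff h i‖ₑ ^ 2
  simp only [Equiv.neg_apply] at hneg
  rw [hneg, tsum_enorm_sq_fourierCoeff hmem,
    ← lintegral_indicator hD]
  congr 1
  funext α
  simp only [hh, hw, Set.indicator]
  split_ifs
  · rw [enorm_mul, mul_pow]
  · simp

theorem ofReal_dyadicEnergy (n : ℕ) (a : ℕ → ℂ) : ENNReal.ofReal (dyadicEnergy n a) =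
    ∑ l ∈ Finset.range (n + 1), ENNReal.ofReal ((6 / 5 : ℝ) ^ l) *
      ∑ j ∈ Finset.range (2 ^ l + 1),
        ‖a (2 ^ n + 2 ^ (n - l) * j) - a (2 ^ n + 2 ^ (n - l) * (2 * (j / 2)))‖ₑ ^ 2 := by
  rw [dyadicEnergy, ENNReal.ofReal_sum_of_nonneg fun _ _ => mul_nonneg (by positivity)
    (Finset.sum_nonneg fun _ _ => by positivity)]
  refine Finset.sum_congr rfl fun l _ => ?_
  rw [ENNReal.ofReal_mul (by positivity), ENNReal.ofReal_sum_of_nonneg fun _ _ => by positivity]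
  congr 1
  refine Finset.sum_congr rfl fun j _ => ?_
  rw [ENNReal.ofReal_pow (norm_nonneg _), ofReal_norm]

theorem measurable_ofReal_dyadicEnergy_circMean (P : ℤ[X]) (n : ℕ) :
    Measurable fun α => ENNReal.ofReal (dyadicEnergy n fun t => circMean P t α) := by
  refine Measurable.ennreal_ofReal ?_
  unfold dyadicEnergy
  refine Finset.measurable_sum _ fun l _ => Measurable.const_mul
    (Finset.measurable_sum _ fun j _ => ?_) _
  exact (((continuous_circMean P _).sub (continuous_circMean P _)).norm.pow 2).measurable

theorem tsum_ofReal_dyadicEnergy_polyMean (P : ℤ[X]) {D : Set UnitAddCircle}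
    (hD : MeasurableSet D) (f : EllTwo) (n : ℕ) :
    ∑' x : ℤ, ENNReal.ofReal (dyadicEnergy n fun t => polyMean P t (freqProj D f) x) =
      ∫⁻ α in D, ENNReal.ofReal (dyadicEnergy n fun t => circMean P t α) *
        ‖latticeFourier f α‖ₑ ^ 2 ∂haarAddCircle := by
  simp only [ofReal_dyadicEnergy]
  have hf : AEMeasurable (fun α => ‖latticeFourier f α‖ₑ ^ 2)
      ((haarAddCircle : Measure UnitAddCircle).restrict D) :=
    ((Lp.aestronglyMeasurable (latticeFourier f)).enorm.pow_const 2).restrict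
  have hm : ∀ t t', AEMeasurable (fun α => ‖circMean P t α - circMean P t' α‖ₑ ^ 2 *
      ‖latticeFourier f α‖ₑ ^ 2) ((haarAddCircle : Measure UnitAddCircle).restrict D) := fun t t' =>
    (((continuous_circMean P t).sub
      (continuous_circMean P t')).measurable.enorm.pow_const 2).aemeasurable.mul hf
  simp only [Finset.sum_mul, mul_assoc]
  rw [Summable.tsum_finsetSum fun _ _ => ENNReal.summable, lintegral_finsetSum']
  · refine Finset.sum_congr rfl fun l _ => ?_
    rw [ENNReal.tsum_mul_left, lintegral_const_mul'', Summable.tsum_finsetSum fun _ _ => ENNReal.summable,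
      lintegral_finsetSum']
    · congr 1
      exact Finset.sum_congr rfl fun j _ => tsum_enorm_sq_polyMean_sub P hD f _ _
    · exact fun j _ => hm _ _
    · exact Finset.aemeasurable_fun_sum _ fun j _ => hm _ _
  · exact fun l _ => (Finset.aemeasurable_fun_sum _ fun j _ => hm _ _).const_mul _

theorem ellTwoNormSq_shortVariation_le (P : ℤ[X]) {D : Set UnitAddCircle} (hD : MeasurableSet D)
    (f : EllTwo) (n : ℕ) :
    ellTwoNormSq (shortVariation P n (freqProj D f)) ≤
      24 * ∫⁻ α, D.indicator (fun α => ENNReal.ofReal (dyadicEnergy n fun t => circMean P t α)) α *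
        ‖latticeFourier f α‖ₑ ^ 2 ∂haarAddCircle := by
  calc _ ≤ ∑' x : ℤ, 24 *
        ENNReal.ofReal (dyadicEnergy n fun t => polyMean P t (freqProj D f) x) := by
        refine ENNReal.tsum_le_tsum fun x => ?_
        refine (variation_two_sq_le_dyadicEnergy n _).trans (le_of_eq ?_)
        rw [ENNReal.ofReal_mul (by norm_num)]
        norm_num
    _ = _ := by
        rw [ENNReal.tsum_mul_left, tsum_ofReal_dyadicEnergy_polyMean P hD, ← lintegral_indicator hD]
        congr 2
        funext α
        simp only [Set.indicator]
        split_ifs <;> simp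

end PolyVariation

theorem mainTheorem7 :
    ∃ δ₀ : ℝ, 0 < δ₀ ∧
      ∀ P : ℤ[X], 0 < P.leadingCoeff →
        ∀ δ : ℝ, 0 < δ → δ < δ₀ →
          ∃ C : ℝ≥0, ∀ f : PolyVariation.EllTwo,
            ∑' n : ℕ, PolyVariation.ellTwoNormSq
                (PolyVariation.shortVariation P n
                  (PolyVariation.freqProj (PolyVariation.majorArcs P δ n) f))
              ≤ (C : ℝ≥0∞) * PolyVariation.ellTwoNormSq (fun x => ‖f x‖ₑ) := by
  refine ⟨1 / 10, by norm_num, fun P hP δ _ hδ => ?_⟩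
  obtain ⟨C, hC⟩ := PolyVariation.exists_tsum_dyadicEnergy_le_of_leadingCoeff_pos P hP hδ
  refine ⟨24 * C, fun f => ?_⟩
  have hmeas := PolyVariation.measurableSet_majorArcs P δ
  calc _ ≤ ∑' n : ℕ, 24 * ∫⁻ α, (PolyVariation.majorArcs P δ n).indicator (fun α => ENNReal.ofReal
        (PolyVariation.dyadicEnergy n fun t => PolyVariation.circMean P t α)) α *
        ‖PolyVariation.latticeFourier f α‖ₑ ^ 2 ∂AddCircle.haarAddCircle :=
        ENNReal.tsum_le_tsum fun n =>
          PolyVariation.ellTwoNormSq_shortVariation_le P (hmeas n) f n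
    _ = 24 * ∫⁻ α, (∑' n : ℕ, (PolyVariation.majorArcs P δ n).indicator (fun α => ENNReal.ofReal
        (PolyVariation.dyadicEnergy n fun t => PolyVariation.circMean P t α)) α) *
        ‖PolyVariation.latticeFourier f α‖ₑ ^ 2 ∂AddCircle.haarAddCircle := by
        rw [ENNReal.tsum_mul_left, ← MeasureTheory.lintegral_tsum]
        · simp only [ENNReal.tsum_mul_right]
        · exact fun n => ((PolyVariation.measurable_ofReal_dyadicEnergy_circMean P n).indicator
            (hmeas n)).aemeasurable.mul
              ((MeasureTheory.Lp.aestronglyMeasurable _).enorm.pow_const 2)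
    -- After exchanging sum and integral, the pointwise bound is applied at a real representative of
    -- α.
    _ ≤ 24 * ∫⁻ α, C * ‖PolyVariation.latticeFourier f α‖ₑ ^ 2 ∂AddCircle.haarAddCircle := by
        gcongr with α
        obtain ⟨x, rfl⟩ := QuotientAddGroup.mk_surjective α
        refine le_trans (le_of_eq ?_) (hC x)
        refine tsum_congr fun n => ?_
        simp only [Set.indicator]
        congr 3
        funext t
        exact PolyVariation.circMean_coe P t x
    _ = _ := by
        rw [MeasureTheory.lintegral_const_mul' _ _ ENNReal.coe_ne_top,
          PolyVariation.lintegral_enorm_sq_latticeFourier, ← mul_assoc]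
        push_cast; rfl
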